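/- **The semiclassical Fourier transform of Hagedorn wave packets.** Let $d\in\mathbb{N}_0$ and $\hbar>0$. For $\psi:\mathbb{R}^d\to\mathbb{C}$ put $$(\mathscr{F}_\hbar\psi)(x)=\frac{1}{(2\pi\hbar)^{d/2}}\int_{\mathbb{R}^d}e^{-\frac{i}{\hbar}x\cdot y}\,\psi(y)\,dy .$$ Let $Q,P$ be complex $d\times d$ matrices with $Q^TP-P^TQ=0$ and $Q^*P-P^*Q=2iI_d$, let $q,p\in\mathbb{R}^d$, and let $(\det Q)^{1/2}$ be either square root of $\det Q$. The Hagedorn wave packets $\varphi_n=\varphi_n^\hbar(Q,P,q,p;\cdot\,)$, $n\in\mathbb{N}_0^d$, are defined by $$\varphi_0(x)=\frac{(\det Q)^{-1/2}}{(\pi\hbar)^{d/4}}\exp\Big\{\tfrac{i}{\hbar}\big[\tfrac12(x-q)^TPQ^{-1}(x-q)+p\cdot(x-q)\big]\Big\},\qquad \varphi_{n+e_j}=\frac{1}{\sqrt{n_j+1}}\,\mathscr{A}_j^*\varphi_n,$$ $$\mathscr{A}^*=\frac{i}{\sqrt{2\hbar}}\big[P^*(\hat x-q)-Q^*(\hat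 p-p)\big],\qquad \hat x_k f=x_kf,\quad \hat p_kf=-i\hbar\,\partial f/\partial x_k .$$ They depend on the chosen square root only through one common sign. Equivalently they are parametrized by $z=(q,p)$ and the real symplectic matrix $$S=\begin{bmatrix}\operatorname{Re}Q&\operatorname{Im}Q\\ \operatorname{Re}P&\operatorname{Im}P\end{bmatrix};$$ we then write $\varphi_n^\hbar(S,z;\cdot\,)$. Let $J=\begin{bmatrix}0&I_d\\-I_d&0\end{bmatrix}$ and $i^{d/2}=e^{i\pi d/4}$. Then, for all such $\hbar,Q,P,q,p$ (that is, for all $\hbar>0$, $S\in\mathsf{Sp}(2d,\mathbb{R})$ and $z=(q,p)\in\mathbb{R}^{2d}$) and all $n\in\mathbb{N}_0^d$, the function $\varphi_n^\hbar(S,z;\cdot\,)$ is integrable and $$\mathscr{F}_\hbar\,\varphi_n^\hbar(S,z;\cdot\,)=i^{d/2}\,e^{-\frac{i}{\hbar}p\cdot q}\,\varphi_n^\hbar(JS,Jz;\cdot\,),$$ or, explicitly, $$\mathscr{F}_\hbar\,\varphi_n^\hbar(Q,P,q,p;\cdot\,)=i^{d/2}\,e^{-\frac{i}{\hbar}p\cdot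 q}\,\varphi_n^\hbar(P,-Q,p,-q;\cdot\,).$$ Here the square root of $\det P$ used on the right-hand side is $(\det P)^{1/2}=(\det Q)^{1/2}\,s(PQ^{-1})$, where $s$ is a continuous function on the Siegel upper half space (complex symmetric $d\times d$ matrices with positive definite imaginary part) with $s(Z)^2=\det Z$ and $s(iI_d)=i^{d/2}$; such an $s$, independent of $\hbar,Q,P,q,p,n$, exists. -/

import Mathlib

open MeasureTheory
open scoped ContDiff Matrix

noncomputable section

namespace Hagedorn

/-- The configuration space `ℝ^d`. -/
abbrev Space (d : ℕ) : Type := EuclideanSpace ℝ (Fin d)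

/-- Complex `d × d` matrices. -/
abbrev CMat (d : ℕ) : Type := Matrix (Fin d) (Fin d) ℂ

/-- Real `2d × 2d` matrices, in `d × d` blocks. -/
abbrev PhaseMat (d : ℕ) : Type := Matrix (Fin d ⊕ Fin d) (Fin d ⊕ Fin d) ℝ

/-- The matrix `J = [[0, I], [-I, 0]]`. -/
def symJ (d : ℕ) : PhaseMat d := Matrix.fromBlocks 0 1 (-1) 0

/-- The complex matrix `Q = A + i B` of `S = [[A, B], [C, D]]`. -/
def blockQ {d : ℕ} (S : PhaseMat d) : CMat d :=
  fun j k => (S (Sum.inl j) (Sum.inl k) : ℂ) + Complex.I * (S (Sum.inl j) (Sum.inr k) : ℂ)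

/-- The complex matrix `P = C + i D` of `S = [[A, B], [C, D]]`. -/
def blockP {d : ℕ} (S : PhaseMat d) : CMat d :=
  fun j k => (S (Sum.inr j) (Sum.inl k) : ℂ) + Complex.I * (S (Sum.inr j) (Sum.inr k) : ℂ)

/-- The Siegel upper half space: complex symmetric matrices with positive definite imaginary
part. -/
def siegel (d : ℕ) : Set (CMat d) :=
  {Z | Z.IsSymm ∧ (Z.map Complex.im).PosDef}

/-- The semiclassical Fourier transform
`(𝓕_ħ ψ)(x) = (2πħ)^{-d/2} ∫ e^{-i x·y/ħ} ψ(y) dy`. -/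
def semiFourier {d : ℕ} (ħ : ℝ) (ψ : Space d → ℂ) (x : Space d) : ℂ :=
  (((2 * Real.pi * ħ) ^ ((d : ℝ) / 2) : ℝ) : ℂ)⁻¹ *
    ∫ y : Space d, Complex.exp (-(Complex.I / ħ) * (∑ k, x k * y k : ℝ)) * ψ y

/-- The momentum operator `-iħ ∂/∂x_k`. -/
def momentum {d : ℕ} (ħ : ℝ) (k : Fin d) (f : Space d → ℂ) (x : Space d) : ℂ :=
  -Complex.I * ħ * fderiv ℝ f x (EuclideanSpace.single k 1)

/-- The `j`-th raising operator
`𝒜*_j = (i / √(2ħ)) [P^* (x̂ - q) - Q^* (p̂ - p)]_j`, with `P^*`, `Q^*` conjugate transposes. -/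
def raising {d : ℕ} (ħ : ℝ) (Q P : CMat d) (q p : Fin d → ℝ) (j : Fin d)
    (f : Space d → ℂ) (x : Space d) : ℂ :=
  Complex.I / (Real.sqrt (2 * ħ) : ℂ) *
    (∑ k, Pᴴ j k * (((x k - q k : ℝ) : ℂ) * f x)
      - ∑ k, Qᴴ j k * (momentum ħ k f x - (p k : ℂ) * f x))

/-- The ground state
`(det Q)^{-1/2} (πħ)^{-d/4} exp((i/ħ) [½ (x-q)ᵀ P Q⁻¹ (x-q) + p·(x-q)])`,
where the number `r` is the chosen square root of `det Q`. -/
def groundState {d : ℕ} (ħ : ℝ) (Q P : CMat d) (r : ℂ) (q p : Fin d → ℝ)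
    (x : Space d) : ℂ :=
  r⁻¹ / (((Real.pi * ħ) ^ ((d : ℝ) / 4) : ℝ) : ℂ) *
    Complex.exp (Complex.I / ħ *
      (1 / 2 * ((fun k => ((x k - q k : ℝ) : ℂ)) ⬝ᵥ
          (P * Q⁻¹) *ᵥ (fun k => ((x k - q k : ℝ) : ℂ)))
        + ((∑ k, p k * (x k - q k) : ℝ) : ℂ)))

/-- The Hagedorn wave packet of multi-index `n`: the ground state raised `n j` times in each
direction `j`, divided by `√(n!)`. The raising operators commute, so this is the family with
`φ_0` the ground state and `φ_{n + e_j} = (n_j + 1)^{-1/2} 𝒜*_j φ_n`; see `wavePacket_zero` and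
`wavePacket_add_single`. -/
def wavePacket {d : ℕ} (ħ : ℝ) (Q P : CMat d) (r : ℂ) (q p : Fin d → ℝ)
    (n : Fin d → ℕ) : Space d → ℂ :=
  (Real.sqrt (∏ j, (n j).factorial : ℕ) : ℂ)⁻¹ •
    (List.finRange d).foldr (fun j f => (raising ħ Q P q p j)^[n j] f)
      (groundState ħ Q P r q p)

/-- The wave packet with parameters `S` (real `2d × 2d` matrix) and `z = (q, p)`; the number `r`
is the chosen square root of `det Q`. -/
def wavePacketS {d : ℕ} (ħ : ℝ) (S : PhaseMat d) (r : ℂ) (z : Fin d ⊕ Fin d → ℝ)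
    (n : Fin d → ℕ) : Space d → ℂ :=
  wavePacket ħ (blockQ S) (blockP S) r (fun k => z (Sum.inl k)) (fun k => z (Sum.inr k)) n

/-! The wave packets satisfy the defining recursion. -/

section Recursion

variable {d : ℕ} {ħ : ℝ} {Q P : CMat d} {q p : Fin d → ℝ}

theorem wavePacket_zero (r : ℂ) :
    wavePacket ħ Q P r q p 0 = groundState ħ Q P r q p := by
  have h : ∀ l : List (Fin d),
      l.foldr (fun j f => (raising ħ Q P q p j)^[(0 : Fin d → ℕ) j] f)
        (groundState ħ Q P r q p) = groundState ħ Q P r q p := by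
    intro l
    induction l with
    | nil => rfl
    | cons a l ih => exact ih
  unfold wavePacket
  rw [h]
  simp

theorem contDiff_groundState (r : ℂ) : ContDiff ℝ ∞ (groundState ħ Q P r q p) := by
  unfold groundState
  simp only [dotProduct, Matrix.mulVec]
  have h : ∀ k : Fin d, ContDiff ℝ ∞ (fun x : Space d => ((x k - q k : ℝ) : ℂ)) := by
    intro k
    have e : ContDiff ℝ ∞ (fun x : Space d => x k - q k) := by fun_prop
    exact Complex.ofRealCLM.contDiff.comp e
  have h' : ContDiff ℝ ∞ (fun x : Space d => ((∑ k, p k * (x k - q k) : ℝ) : ℂ)) := by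
    have e : ContDiff ℝ ∞ (fun x : Space d => ∑ k, p k * (x k - q k)) := by fun_prop
    exact Complex.ofRealCLM.contDiff.comp e
  fun_prop

theorem contDiff_partial {f : Space d → ℂ} (hf : ContDiff ℝ ∞ f) (v : Space d) :
    ContDiff ℝ ∞ (fun x => fderiv ℝ f x v) :=
  (hf.fderiv_right (m := ∞) (by simp)).clm_apply contDiff_const

/-- The affine symbol that multiplies `f` in the raising operator. -/
theorem raising_eq (j : Fin d) (f : Space d → ℂ) (x : Space d) :
    raising ħ Q P q p j f x = Complex.I / (Real.sqrt (2 * ħ) : ℂ) *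
      ((∑ k, (Pᴴ j k * ((x k : ℂ) - q k) + Qᴴ j k * p k)) * f x
        + Complex.I * ħ * ∑ k, Qᴴ j k * fderiv ℝ f x (EuclideanSpace.single k 1)) := by
  unfold raising momentum
  congr 1
  rw [← Finset.sum_sub_distrib, Finset.sum_mul, Finset.mul_sum, ← Finset.sum_add_distrib]
  refine Finset.sum_congr rfl fun k _ => ?_
  push_cast
  ring

theorem contDiff_raising {f : Space d → ℂ} (hf : ContDiff ℝ ∞ f) (j : Fin d) :
    ContDiff ℝ ∞ (raising ħ Q P q p j f) := by
  have h : raising ħ Q P q p j f = _ := funext (raising_eq j f)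
  rw [h]
  have h1 : ∀ k : Fin d, ContDiff ℝ ∞ (fun x : Space d => (x k : ℂ)) := fun k => by
    have e : ContDiff ℝ ∞ (fun x : Space d => x k) := by fun_prop
    exact Complex.ofRealCLM.contDiff.comp e
  have h2 := fun k : Fin d => contDiff_partial hf (EuclideanSpace.single k 1)
  fun_prop

theorem partial_raising {f : Space d → ℂ} (hf : ContDiff ℝ ∞ f) (j l : Fin d) (x : Space d) :
    fderiv ℝ (raising ħ Q P q p j f) x (EuclideanSpace.single l 1) =
      Complex.I / (Real.sqrt (2 * ħ) : ℂ) *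
      ((∑ k, (Pᴴ j k * ((x k : ℂ) - q k) + Qᴴ j k * p k)) *
          fderiv ℝ f x (EuclideanSpace.single l 1)
        + Pᴴ j l * f x
        + Complex.I * ħ * ∑ k, Qᴴ j k *
            fderiv ℝ (fun y => fderiv ℝ f y (EuclideanSpace.single k 1)) x
              (EuclideanSpace.single l 1)) := by
  have h : raising ħ Q P q p j f = _ := funext (raising_eq j f)
  rw [h]
  have h1 : ∀ k : Fin d, HasFDerivAt (fun x : Space d => (x k : ℂ))
      (Complex.ofRealCLM.comp (EuclideanSpace.proj k : Space d →L[ℝ] ℝ)) x := fun k =>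
    (Complex.ofRealCLM.comp (EuclideanSpace.proj k : Space d →L[ℝ] ℝ)).hasFDerivAt
  have h2 := fun k : Fin d =>
    (((contDiff_partial hf (EuclideanSpace.single k 1)).differentiable (by simp)) x).hasFDerivAt
  have h3 := ((hf.differentiable (by simp)) x).hasFDerivAt
  have h4 := HasFDerivAt.fun_sum (u := Finset.univ) fun (k : Fin d) _ =>
    (((h1 k).sub_const (q k : ℂ)).const_mul (Pᴴ j k)).add_const (Qᴴ j k * (p k : ℂ))
  have h5 := HasFDerivAt.fun_sum (u := Finset.univ) fun (k : Fin d) _ =>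
    (h2 k).const_mul (Qᴴ j k)
  have h6 := (((h4.mul h3).add (h5.const_mul (Complex.I * ħ)))).const_mul
    (Complex.I / (Real.sqrt (2 * ħ) : ℂ))
  have h7 := congrArg (fun T => T (EuclideanSpace.single l (1 : ℝ))) h6.fderiv
  refine Eq.trans ?_ (h7.trans ?_)
  · rfl
  · have e : ∑ k, (starRingEnd ℂ) (P k j) * (((if k = l then 1 else 0 : ℝ)) : ℂ) =
        (starRingEnd ℂ) (P l j) := by
      rw [Finset.sum_eq_single l]
      · simp
      · intro k _ hk
        simp [hk]
      · simp
    simp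
    rw [e]
    ring

theorem partial_comm {f : Space d → ℂ} (hf : ContDiff ℝ ∞ f) (v w x : Space d) :
    fderiv ℝ (fun y => fderiv ℝ f y v) x w = fderiv ℝ (fun y => fderiv ℝ f y w) x v := by
  have hd : DifferentiableAt ℝ (fderiv ℝ f) x :=
    ((hf.fderiv_right (m := ∞) (by simp)).differentiable (by simp)) x
  have hs : IsSymmSndFDerivAt ℝ f x :=
    hf.contDiffAt.isSymmSndFDerivAt (by
      rw [minSmoothness_of_isRCLikeNormedField]
      exact WithTop.coe_le_coe.mpr le_top)
  rw [fderiv_clm_apply hd (differentiableAt_const _),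
    fderiv_clm_apply hd (differentiableAt_const _)]
  simpa using hs w v

theorem raising_comm (hQP : Qᵀ * P - Pᵀ * Q = 0) {f : Space d → ℂ} (hf : ContDiff ℝ ∞ f)
    (i j : Fin d) :
    raising ħ Q P q p i (raising ħ Q P q p j f) =
      raising ħ Q P q p j (raising ħ Q P q p i f) := by
  have key : ∑ k, Qᴴ i k * Pᴴ j k = ∑ k, Qᴴ j k * Pᴴ i k := by
    have h := congrFun (congrFun hQP i) j
    have h' := congrArg star h
    simp only [Matrix.sub_apply, Matrix.mul_apply, Matrix.transpose_apply, Matrix.zero_apply,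
      star_sub, star_sum, star_mul, star_zero] at h'
    have h'' := sub_eq_zero.mp h'
    simp only [Matrix.conjTranspose_apply]
    calc _ = ∑ k, star (P k j) * star (Q k i) := Finset.sum_congr rfl fun k _ => mul_comm _ _
      _ = _ := h''
  have key2 : ∀ x : Space d, ∑ l, Qᴴ i l * ∑ k, Qᴴ j k *
        fderiv ℝ (fun y => fderiv ℝ f y (EuclideanSpace.single k 1)) x
          (EuclideanSpace.single l 1) =
      ∑ l, Qᴴ j l * ∑ k, Qᴴ i k *
        fderiv ℝ (fun y => fderiv ℝ f y (EuclideanSpace.single k 1)) x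
          (EuclideanSpace.single l 1) := by
    intro x
    simp only [Finset.mul_sum]
    rw [Finset.sum_comm]
    refine Finset.sum_congr rfl fun k _ => Finset.sum_congr rfl fun l _ => ?_
    rw [partial_comm hf]
    ring
  funext x
  have expand : ∀ a b : Fin d, raising ħ Q P q p a (raising ħ Q P q p b f) x =
      (Complex.I / (Real.sqrt (2 * ħ) : ℂ)) ^ 2 *
      ((∑ k, (Pᴴ a k * ((x k : ℂ) - q k) + Qᴴ a k * p k)) *
          ((∑ k, (Pᴴ b k * ((x k : ℂ) - q k) + Qᴴ b k * p k)) * f x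
            + Complex.I * ħ * ∑ k, Qᴴ b k * fderiv ℝ f x (EuclideanSpace.single k 1))
        + Complex.I * ħ * ((∑ k, (Pᴴ b k * ((x k : ℂ) - q k) + Qᴴ b k * p k)) *
            (∑ l, Qᴴ a l * fderiv ℝ f x (EuclideanSpace.single l 1))
          + (∑ l, Qᴴ a l * Pᴴ b l) * f x
          + Complex.I * ħ * ∑ l, Qᴴ a l * ∑ k, Qᴴ b k *
            fderiv ℝ (fun y => fderiv ℝ f y (EuclideanSpace.single k 1)) x
              (EuclideanSpace.single l 1))) := by
    intro a b
    have hp := fun l => partial_raising (ħ := ħ) (Q := Q) (P := P) (q := q) (p := p) hf b l x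
    have e : ∑ l, Qᴴ a l * fderiv ℝ (raising ħ Q P q p b f) x (EuclideanSpace.single l 1) =
        (Complex.I / (Real.sqrt (2 * ħ) : ℂ)) *
          ((∑ k, (Pᴴ b k * ((x k : ℂ) - q k) + Qᴴ b k * p k)) *
            (∑ l, Qᴴ a l * fderiv ℝ f x (EuclideanSpace.single l 1))
          + (∑ l, Qᴴ a l * Pᴴ b l) * f x
          + Complex.I * ħ * ∑ l, Qᴴ a l * ∑ k, Qᴴ b k *
            fderiv ℝ (fun y => fderiv ℝ f y (EuclideanSpace.single k 1)) x
              (EuclideanSpace.single l 1)) := by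
      generalize (∑ k, (Pᴴ b k * ((x k : ℂ) - q k) + Qᴴ b k * p k)) = c at hp ⊢
      rw [Finset.mul_sum, Finset.sum_mul, Finset.mul_sum, ← Finset.sum_add_distrib,
        ← Finset.sum_add_distrib, Finset.mul_sum]
      refine Finset.sum_congr rfl fun l _ => ?_
      rw [hp]
      ring
    rw [raising_eq, e, raising_eq]
    ring
  rw [expand, expand, key, key2]
  ring

theorem raising_smul (c : ℂ) (f : Space d → ℂ) (j : Fin d) :
    raising ħ Q P q p j (c • f) = c • raising ħ Q P q p j f := by
  funext x
  rw [Pi.smul_apply, raising_eq, raising_eq, fderiv_const_smul_field]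
  simp only [Pi.smul_apply, smul_apply, smul_eq_mul, mul_left_comm _ c,
    ← Finset.mul_sum]
  ring

theorem contDiff_iterate_raising {f : Space d → ℂ} (hf : ContDiff ℝ ∞ f) (j : Fin d) (m : ℕ) :
    ContDiff ℝ ∞ ((raising ħ Q P q p j)^[m] f) := by
  induction m with
  | zero => simpa using hf
  | succ m ih => rw [Function.iterate_succ_apply']; exact contDiff_raising ih j

theorem contDiff_foldr {f : Space d → ℂ} (hf : ContDiff ℝ ∞ f) (n : Fin d → ℕ)
    (l : List (Fin d)) :
    ContDiff ℝ ∞ (l.foldr (fun j f => (raising ħ Q P q p j)^[n j] f) f) := by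
  induction l with
  | nil => simpa using hf
  | cons a l ih => exact contDiff_iterate_raising ih a _

theorem iterate_raising_comm (hQP : Qᵀ * P - Pᵀ * Q = 0) {f : Space d → ℂ}
    (hf : ContDiff ℝ ∞ f) (i j : Fin d) (m : ℕ) :
    (raising ħ Q P q p i)^[m] (raising ħ Q P q p j f) =
      raising ħ Q P q p j ((raising ħ Q P q p i)^[m] f) := by
  induction m with
  | zero => rfl
  | succ m ih =>
    rw [Function.iterate_succ_apply', Function.iterate_succ_apply', ih,
      raising_comm hQP (contDiff_iterate_raising hf i m)]

theorem foldr_add_single (hQP : Qᵀ * P - Pᵀ * Q = 0) {f : Space d → ℂ} (hf : ContDiff ℝ ∞ f)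
    (n : Fin d → ℕ) (j : Fin d) (l : List (Fin d)) (hl : l.Nodup) :
    l.foldr (fun i g => (raising ħ Q P q p i)^[(n + Pi.single j 1 : Fin d → ℕ) i] g) f =
      if j ∈ l then
        raising ħ Q P q p j (l.foldr (fun i g => (raising ħ Q P q p i)^[n i] g) f)
      else l.foldr (fun i g => (raising ħ Q P q p i)^[n i] g) f := by
  induction l with
  | nil => simp
  | cons a l ih =>
    have ih' := ih hl.of_cons
    simp only [List.foldr_cons]
    rw [ih']
    by_cases haj : a = j
    · subst haj
      have : a ∉ l := (List.nodup_cons.mp hl).1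
      simp [this, Function.iterate_succ_apply']
    · have e : (n + Pi.single j 1 : Fin d → ℕ) a = n a := by simp [haj]
      rw [e]
      by_cases hj : j ∈ l
      · simp only [hj, if_true, List.mem_cons, or_true]
        exact iterate_raising_comm hQP (contDiff_foldr hf n l) a j (n a)
      · simp [hj, Ne.symm haj]

/-- The recursion `φ_{n + e_j} = (n_j + 1)^{-1/2} 𝒜*_j φ_n`. -/
theorem wavePacket_add_single (hQP : Qᵀ * P - Pᵀ * Q = 0) (r : ℂ) (n : Fin d → ℕ)
    (j : Fin d) :
    wavePacket ħ Q P r q p (n + Pi.single j 1) =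
      (Real.sqrt (n j + 1) : ℂ)⁻¹ • raising ħ Q P q p j (wavePacket ħ Q P r q p n) := by
  unfold wavePacket
  rw [foldr_add_single hQP (contDiff_groundState r) n j _ (List.nodup_finRange d),
    if_pos (List.mem_finRange j), raising_smul, smul_smul]
  congr 1
  have h : (∏ i, ((n + Pi.single j 1 : Fin d → ℕ) i).factorial) =
      (n j + 1) * ∏ i, (n i).factorial := by
    rw [← Finset.mul_prod_erase _ _ (Finset.mem_univ j),
      ← Finset.mul_prod_erase _ (fun i => (n i).factorial) (Finset.mem_univ j), ← mul_assoc]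
    congr 1
    · simp [Nat.factorial_succ]
    · refine Finset.prod_congr rfl fun i hi => ?_
      simp [Finset.ne_of_mem_erase hi]
  rw [h, Nat.cast_mul, Real.sqrt_mul (by positivity)]
  push_cast
  rw [mul_inv]

end Recursion

end Hagedorn

end

/-! The transform `semiFourier` sends multiplication by `x_k` to `-p̂_k` and `p̂_k` to
multiplication by `x_k`. Hence it carries `P^*(x̂ - q) - Q^*(p̂ - p)` to `(-Q)^*(x̂ - p) - P^*(p̂ +
q)`, the expression with parameters `(P, -Q, p, -q)` (`semiFourier_raising`). No constant appears
here, so the phase for every `n` is the one for the ground state.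

The ground state is a Gaussian with matrix `Z = P Q⁻¹`, a point of the Siegel upper half space
(`mul_inv_mem_siegel`). Its transform is a Gaussian with matrix `-Z⁻¹ = (-Q) P⁻¹`
(`semiFourier_groundState`), and the prefactor is the Gaussian integral `gaussInt Z`. The branch of
the root is defined by this prefactor: `sqrtDet Z` is `i^{d/2} (2π)^{d/2} / gaussInt Z`. Its
continuity is dominated convergence (`continuousOn_gaussInt`), and its square needs only the square
of the Gaussian integral, found by diagonalizing the real and imaginary parts of `Z` simultaneously
(`gaussInt_spec`). No branch has to be followed along a path.

Intertwining needs integrability of `f`, `x_k f` and `∂_k f`. All functions that occur are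
polynomials times the ground state (`PolyMul`), a class closed under these operations and with
Gaussian decay. The symplectic form is the explicit one read in blocks. -/

namespace Hagedorn

/-! ### Simultaneous diagonalization and quadratic forms -/

section

variable {d : ℕ}

/-- A positive definite real form and a symmetric real form are simultaneously diagonalizable. -/
theorem exists_simultaneous_diagonalization {X Y : Matrix (Fin d) (Fin d) ℝ} (hX : X.IsSymm)
    (hY : Y.PosDef) :
    ∃ (M : Matrix (Fin d) (Fin d) ℝ) (l : Fin d → ℝ),
      M.det ≠ 0 ∧ Mᵀ * Y * M = 1 ∧ Mᵀ * X * M = Matrix.diagonal l := by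
  open scoped MatrixOrder Matrix.Norms.L2Operator in
  obtain ⟨B, hB⟩ : ∃ B : Matrix (Fin d) (Fin d) ℝ, Y = Bᵀ * B := by
    obtain ⟨B, hB⟩ := CStarAlgebra.nonneg_iff_eq_star_mul_self.mp hY.posSemidef.nonneg
    exact ⟨B, by simpa [Matrix.star_eq_conjTranspose] using hB⟩
  have hBdet : IsUnit B.det := by
    have h := (Matrix.isUnit_iff_isUnit_det _).mp hY.isUnit
    rw [hB, Matrix.det_mul] at h
    exact isUnit_of_mul_isUnit_right h
  -- In the coordinates `B u` the form `Y = Bᵀ B` is Euclidean, so an orthogonal change of basis can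
  -- diagonalize `X` without disturbing it.
  have hH : (B⁻¹ᵀ * X * B⁻¹).IsHermitian := by
    rw [Matrix.IsHermitian, Matrix.conjTranspose_eq_transpose_of_trivial, Matrix.transpose_mul,
      Matrix.transpose_mul, hX.eq, Matrix.transpose_transpose, Matrix.mul_assoc]
  set U : Matrix (Fin d) (Fin d) ℝ := (hH.eigenvectorUnitary : Matrix (Fin d) (Fin d) ℝ) with hU
  have hUU : Uᵀ * U = 1 := by
    simpa [Matrix.star_eq_conjTranspose] using Unitary.coe_star_mul_self hH.eigenvectorUnitary
  have hdiag := hH.conjStarAlgAut_star_eigenvectorUnitary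
  rw [Unitary.conjStarAlgAut_star_apply] at hdiag
  refine ⟨B⁻¹ * U, hH.eigenvalues, ?_, ?_, ?_⟩
  · have h1 : U.det ≠ 0 := by
      intro h
      simpa [h] using congrArg Matrix.det hUU
    rw [Matrix.det_mul]
    exact mul_ne_zero ((Matrix.isUnit_nonsing_inv_det _ hBdet).ne_zero) h1
  · rw [Matrix.transpose_mul, hB]
    calc Uᵀ * B⁻¹ᵀ * (Bᵀ * B) * (B⁻¹ * U) = Uᵀ * (B * B⁻¹)ᵀ * (B * B⁻¹) * U := by
          simp only [Matrix.mul_assoc, Matrix.transpose_mul]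
      _ = 1 := by rw [Matrix.mul_nonsing_inv _ hBdet]; simpa using hUU
  · rw [Matrix.transpose_mul]
    calc Uᵀ * B⁻¹ᵀ * X * (B⁻¹ * U) = Uᵀ * (B⁻¹ᵀ * X * B⁻¹) * U := by
          simp only [Matrix.mul_assoc]
      _ = _ := by
        simpa [Matrix.star_eq_conjTranspose, hU, Function.comp_def] using hdiag

theorem map_ofReal_mul (A B : Matrix (Fin d) (Fin d) ℝ) :
    (A * B).map Complex.ofReal = A.map Complex.ofReal * B.map Complex.ofReal :=
  Matrix.map_mul (f := Complex.ofRealHom)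

theorem map_re_add_map_im (Z : CMat d) :
    Z = (Z.map Complex.re).map Complex.ofReal
      + Complex.I • (Z.map Complex.im).map Complex.ofReal := by
  ext i j
  simp [mul_comm Complex.I, Complex.re_add_im]

/-- A real congruence turns the imaginary part into the identity and the real part into a diagonal
matrix. It is a real change of variables, so Gaussian integrals with matrix `Z` split into
one-dimensional ones. -/
theorem exists_diagonalization_of_mem_siegel {Z : CMat d} (hZ : Z ∈ siegel d) :
    ∃ (M : Matrix (Fin d) (Fin d) ℝ) (l : Fin d → ℝ), M.det ≠ 0 ∧
      (M.map Complex.ofReal)ᵀ * Z * M.map Complex.ofReal =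
        Matrix.diagonal fun k => (l k : ℂ) + Complex.I := by
  have hX : (Z.map Complex.re).IsSymm := by
    rw [Matrix.IsSymm, ← Matrix.transpose_map, hZ.1.eq]
  obtain ⟨M, l, hM, h1, h2⟩ := exists_simultaneous_diagonalization hX hZ.2
  refine ⟨M, l, hM, ?_⟩
  have h1' := congrArg (fun A => A.map Complex.ofReal) h1
  have h2' := congrArg (fun A => A.map Complex.ofReal) h2
  simp only [map_ofReal_mul] at h1' h2'
  rw [← Matrix.transpose_map]
  conv_lhs => rw [map_re_add_map_im Z]
  rw [Matrix.mul_add, Matrix.add_mul, Matrix.mul_smul, Matrix.smul_mul, h1', h2']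
  ext i j
  by_cases hij : i = j
  · subst hij; simp
  · simp [hij]

/-- A positive definite real form dominates a multiple of the Euclidean one. -/
theorem exists_lower_bound_of_posDef {Y : Matrix (Fin d) (Fin d) ℝ} (hY : Y.PosDef) :
    ∃ c : ℝ, 0 < c ∧ ∀ u : Fin d → ℝ, c * ∑ k, u k ^ 2 ≤ u ⬝ᵥ Y *ᵥ u := by
  obtain ⟨M, -, hM, h1, -⟩ := exists_simultaneous_diagonalization Matrix.isSymm_one hY
  have hMu : IsUnit M.det := hM.isUnit
  set K : ℝ := ∑ i, ∑ j, M i j ^ 2 with hK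
  have hK0 : 0 ≤ K := Finset.sum_nonneg fun i _ => Finset.sum_nonneg fun j _ => sq_nonneg _
  -- `K` is the squared Frobenius norm of `M`, so Cauchy–Schwarz on each row of `u = M v` gives
  -- `|u|² ≤ K |v|²`, and `|v|²` is the value of the form `Y` at `u`. Adding 1 keeps the constant
  -- meaningful when `K = 0`, as for `d = 0`.
  refine ⟨(K + 1)⁻¹, by positivity, fun u => ?_⟩
  obtain ⟨v, hu⟩ : ∃ v, u = M *ᵥ v := ⟨M⁻¹ *ᵥ u, by
    rw [Matrix.mulVec_mulVec, Matrix.mul_nonsing_inv _ hMu, Matrix.one_mulVec]⟩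
  have hq : u ⬝ᵥ Y *ᵥ u = ∑ k, v k ^ 2 := by
    rw [hu, Matrix.mulVec_mulVec, dotProduct_comm, ← Matrix.dotProduct_transpose_mulVec,
      Matrix.mulVec_mulVec, ← Matrix.mul_assoc, h1, Matrix.one_mulVec, dotProduct]
    simp [sq]
  have hle : ∑ k, u k ^ 2 ≤ K * ∑ k, v k ^ 2 := by
    rw [hK, Finset.sum_mul]
    refine Finset.sum_le_sum fun i _ => ?_
    rw [hu]
    exact Finset.sum_mul_sq_le_sq_mul_sq Finset.univ (M i) v
  have hv0 : 0 ≤ ∑ k, v k ^ 2 := Finset.sum_nonneg fun k _ => sq_nonneg _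
  rw [hq, inv_mul_le_iff₀ (by positivity)]
  linarith

/-- The complex quadratic form `u ↦ uᵀ Z u` on real vectors. -/
def quadForm (Z : CMat d) (u : Fin d → ℝ) : ℂ :=
  (fun k => (u k : ℂ)) ⬝ᵥ Z *ᵥ (fun k => (u k : ℂ))

theorem quadForm_eq_sum (Z : CMat d) (u : Fin d → ℝ) :
    quadForm Z u = ∑ i, ∑ j, Z i j * (u i * u j) := by
  simp only [quadForm, dotProduct, Matrix.mulVec, Finset.mul_sum]
  exact Finset.sum_congr rfl fun i _ => Finset.sum_congr rfl fun j _ => by ring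

theorem im_quadForm (Z : CMat d) (u : Fin d → ℝ) :
    (quadForm Z u).im = u ⬝ᵥ (Z.map Complex.im) *ᵥ u := by
  rw [quadForm_eq_sum]
  simp only [dotProduct, Matrix.mulVec, Finset.mul_sum, Complex.im_sum]
  refine Finset.sum_congr rfl fun i _ => Finset.sum_congr rfl fun j _ => ?_
  rw [← Complex.ofReal_mul, Complex.im_mul_ofReal, Matrix.map_apply]
  ring

theorem ofReal_mulVec (M : Matrix (Fin d) (Fin d) ℝ) (v : Fin d → ℝ) :
    (fun k => ((M *ᵥ v) k : ℂ)) = M.map Complex.ofReal *ᵥ fun k => (v k : ℂ) := by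
  ext k
  simp [Matrix.mulVec, dotProduct]

theorem quadForm_mulVec (Z : CMat d) (M : Matrix (Fin d) (Fin d) ℝ) (v : Fin d → ℝ) :
    quadForm Z (M *ᵥ v) =
      quadForm ((M.map Complex.ofReal)ᵀ * Z * M.map Complex.ofReal) v := by
  rw [quadForm, quadForm, ofReal_mulVec, Matrix.mulVec_mulVec, dotProduct_comm,
    ← Matrix.dotProduct_transpose_mulVec, Matrix.mulVec_mulVec, ← Matrix.mul_assoc]

theorem quadForm_diagonal (D : Fin d → ℂ) (v : Fin d → ℝ) :
    quadForm (Matrix.diagonal D) v = ∑ k, D k * (v k : ℂ) ^ 2 := by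
  simp only [quadForm, dotProduct, Matrix.mulVec_diagonal]
  exact Finset.sum_congr rfl fun k _ => by ring

end

/-! ### The Gaussian integral and its square -/

section

variable {d : ℕ}

theorem integral_comp_mulVec {M : Matrix (Fin d) (Fin d) ℝ} (hM : M.det ≠ 0)
    {f : (Fin d → ℝ) → ℂ} (hf : Continuous f) :
    ∫ v, f (M *ᵥ v) = ((|M.det|⁻¹ : ℝ) : ℂ) * ∫ u, f u := by
  have h := Real.map_matrix_volume_pi_eq_smul_volume_pi hM
  have h' : ∫ u, f u ∂(Measure.map (Matrix.toLin' M) volume) = ∫ v, f (M *ᵥ v) := by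
    rw [integral_map (LinearMap.continuous_on_pi _).aemeasurable hf.aestronglyMeasurable]
    rfl
  rw [← h', h, integral_smul_measure, ENNReal.toReal_ofReal (abs_nonneg _), abs_inv,
    Complex.real_smul]

theorem continuous_quadForm (Z : CMat d) : Continuous (quadForm Z) := by
  simp only [funext (quadForm_eq_sum Z)]
  fun_prop

/-- The Gaussian integral `∫ exp((i/2) uᵀ Z u) du`. -/
noncomputable def gaussInt (Z : CMat d) : ℂ :=
  ∫ u : Fin d → ℝ, Complex.exp (Complex.I * (quadForm Z u / 2))

theorem inv_eq_of_congruence {Z : CMat d} {M : Matrix (Fin d) (Fin d) ℂ} (hM : IsUnit M.det)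
    {D : Fin d → ℂ} (hD : ∀ k, D k ≠ 0) (h : Mᵀ * Z * M = Matrix.diagonal D) :
    Z⁻¹ = M * Matrix.diagonal (fun k => (D k)⁻¹) * Mᵀ := by
  have hMt : IsUnit Mᵀ.det := by rwa [Matrix.det_transpose]
  refine Matrix.inv_eq_right_inv ?_
  have h1 : Z = Mᵀ⁻¹ * Matrix.diagonal D * M⁻¹ := by
    rw [← h, Matrix.mul_assoc, Matrix.mul_assoc, Matrix.mul_assoc, Matrix.mul_nonsing_inv _ hM,
      Matrix.mul_one, Matrix.nonsing_inv_mul_cancel_left _ _ hMt]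
  calc Z * (M * Matrix.diagonal (fun k => (D k)⁻¹) * Mᵀ)
      = Mᵀ⁻¹ * (Matrix.diagonal D * (M⁻¹ * M) * Matrix.diagonal (fun k => (D k)⁻¹)) * Mᵀ := by
        rw [h1]; simp only [Matrix.mul_assoc]
    _ = 1 := by
      rw [Matrix.nonsing_inv_mul _ hM, Matrix.mul_one, Matrix.diagonal_mul_diagonal]
      simp only [mul_inv_cancel₀ (hD _), Matrix.diagonal_one, Matrix.mul_one]
      exact Matrix.nonsing_inv_mul _ hMt

/-- After `u = M v` the integral is a product of one-dimensional Gaussians. The linear term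
contributes only the exponential of `Z⁻¹`; the remaining product of principal roots does not depend
on `w`, so it is kept as `gaussInt Z` and evaluated only up to sign, by squaring. -/
theorem gaussInt_spec {Z : CMat d} (hZ : Z ∈ siegel d) :
    (∀ w : Fin d → ℝ,
      ∫ u : Fin d → ℝ, Complex.exp (Complex.I * (quadForm Z u / 2 - ∑ k, (w k : ℂ) * u k)) =
        gaussInt Z * Complex.exp (-Complex.I * (quadForm Z⁻¹ w / 2))) ∧
    gaussInt Z ^ 2 * ((-Complex.I) • Z).det = (2 * Real.pi : ℂ) ^ d := by
  obtain ⟨M, l, hM, hD⟩ := exists_diagonalization_of_mem_siegel hZ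
  set Mc : CMat d := M.map Complex.ofReal with hMc
  have hdet : Mc.det = (M.det : ℂ) := (RingHom.map_det Complex.ofRealHom M).symm
  have hMu : IsUnit Mc.det := by rw [hdet]; exact (Complex.ofReal_ne_zero.mpr hM).isUnit
  have hl : ∀ k, (l k : ℂ) + Complex.I ≠ 0 := fun k h => by
    simpa using congrArg Complex.im h
  have hinv := inv_eq_of_congruence hMu hl hD
  -- The exponent in the variable `v_k` is `-b_k v_k²`, and `b_k = 1/2 - i l_k / 2` has real part
  -- `1/2`.
  set b : Fin d → ℂ := fun k => -Complex.I / 2 * (l k + Complex.I) with hb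
  have hbre : ∀ k, 0 < (b k).re := fun k => by
    have : b k = 1 / 2 + ((-(l k) / 2 : ℝ) : ℂ) * Complex.I := by
      rw [hb]; push_cast; linear_combination (-1 / 2 : ℂ) * Complex.I_sq
    rw [this]; simp
  have hb0 : ∀ k, b k ≠ 0 := fun k h => by simpa [h] using hbre k
  have key : ∀ w : Fin d → ℝ, ((|M.det|⁻¹ : ℝ) : ℂ) *
      ∫ u : Fin d → ℝ, Complex.exp (Complex.I * (quadForm Z u / 2 - ∑ k, (w k : ℂ) * u k)) =
      (∏ k, (Real.pi / b k) ^ (1 / 2 : ℂ)) *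
        Complex.exp (-Complex.I * (quadForm Z⁻¹ w / 2)) := by
    intro w
    have hcont : Continuous fun u : Fin d → ℝ =>
        Complex.exp (Complex.I * (quadForm Z u / 2 - ∑ k, (w k : ℂ) * u k)) := by
      have := continuous_quadForm Z
      fun_prop
    rw [← integral_comp_mulVec hM hcont]
    set c : Fin d → ℂ := fun k => -Complex.I * ((Mᵀ *ᵥ w) k : ℂ) with hc
    have hexp : ∀ v : Fin d → ℝ,
        Complex.I * (quadForm Z (M *ᵥ v) / 2 - ∑ k, (w k : ℂ) * ((M *ᵥ v) k : ℝ)) =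
          -∑ k, b k * (v k : ℂ) ^ 2 + ∑ k, c k * v k := by
      intro v
      have h1 : ∑ k, (w k : ℂ) * ((M *ᵥ v) k : ℝ) = ∑ k, ((Mᵀ *ᵥ w) k : ℂ) * v k := by
        have : w ⬝ᵥ M *ᵥ v = (Mᵀ *ᵥ w) ⬝ᵥ v := by
          rw [← Matrix.dotProduct_transpose_mulVec, dotProduct_comm]
        simpa [dotProduct] using congrArg Complex.ofReal this
      rw [h1, quadForm_mulVec, ← hMc, hD, quadForm_diagonal, Finset.sum_div, mul_sub,
        Finset.mul_sum, Finset.mul_sum, sub_eq_add_neg, ← Finset.sum_neg_distrib,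
        ← Finset.sum_neg_distrib]
      congr 1 <;> refine Finset.sum_congr rfl fun k _ => ?_
      · rw [hb]; ring
      · rw [hc]; ring
    simp only [hexp]
    rw [GaussianFourier.integral_cexp_neg_sum_mul_add hbre, Finset.prod_mul_distrib,
      ← Complex.exp_sum]
    congr 2
    have hq : quadForm Z⁻¹ w = ∑ k, ((l k : ℂ) + Complex.I)⁻¹ * ((Mᵀ *ᵥ w) k : ℂ) ^ 2 := by
      rw [← quadForm_diagonal, quadForm_mulVec, hinv, Matrix.transpose_map,
        ← hMc, Matrix.transpose_transpose]
    rw [hq, Finset.sum_div, Finset.mul_sum]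
    refine Finset.sum_congr rfl fun k _ => ?_
    have := hl k
    rw [hb, hc]
    field_simp
    ring
  -- The case `w = 0` trades the product of roots for `gaussInt Z`.
  have h0 : ((|M.det|⁻¹ : ℝ) : ℂ) * gaussInt Z = ∏ k, (Real.pi / b k) ^ (1 / 2 : ℂ) := by
    simpa [gaussInt, quadForm] using key 0
  have hM0 : ((|M.det|⁻¹ : ℝ) : ℂ) ≠ 0 :=
    Complex.ofReal_ne_zero.mpr (inv_ne_zero (abs_ne_zero.mpr hM))
  refine ⟨fun w => mul_left_cancel₀ hM0 ?_, ?_⟩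
  · rw [key, ← h0, mul_assoc]
  · have h2 : (((|M.det|⁻¹ : ℝ) : ℂ) * gaussInt Z) ^ 2 = ∏ k, (Real.pi / b k) := by
      rw [h0, ← Finset.prod_pow]
      refine Finset.prod_congr rfl fun k _ => ?_
      rw [← Complex.cpow_nat_mul]
      norm_num
    have h3 : ∏ k, (2 * b k) = Mc.det ^ 2 * ((-Complex.I) • Z).det := by
      have h4 := congrArg Matrix.det (congrArg (fun A => (-Complex.I) • A) hD)
      simp only [Matrix.det_smul, Matrix.det_mul, Matrix.det_transpose, Matrix.det_diagonal,
        Fintype.card_fin] at h4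
      rw [Matrix.det_smul, Fintype.card_fin]
      calc ∏ k, (2 * b k) = ∏ k, (-Complex.I * (l k + Complex.I)) :=
            Finset.prod_congr rfl fun k _ => by rw [hb]; ring
        _ = (-Complex.I) ^ d * ∏ k, ((l k : ℂ) + Complex.I) := by
            rw [Finset.prod_mul_distrib]; simp
        _ = _ := by rw [← h4]; ring
    have h5 : (∏ k, ((Real.pi : ℂ) / b k)) * ∏ k, (2 * b k) = (2 * Real.pi : ℂ) ^ d := by
      rw [← Finset.prod_mul_distrib]
      rw [Finset.prod_congr rfl (g := fun _ => (2 * Real.pi : ℂ)) fun k _ => by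
        have := hb0 k
        field_simp]
      simp
    rw [← h2, h3, hdet] at h5
    rw [← h5]
    -- The Jacobian of the substitution cancels the determinant factor of the congruence.
    have h6 : (((|M.det|⁻¹ : ℝ) : ℂ)) ^ 2 * (M.det : ℂ) ^ 2 = 1 := by
      norm_cast
      rw [inv_pow, sq_abs, inv_mul_cancel₀ (pow_ne_zero _ hM)]
    linear_combination (-(gaussInt Z ^ 2 * ((-Complex.I) • Z).det)) * h6

end

/-! ### Continuity of the Gaussian integral and the branch of the root -/

section

variable {d : ℕ}

theorem smul_mem_siegel {Z : CMat d} (hZ : Z ∈ siegel d) {t : ℝ} (ht : 0 < t) :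
    (t : ℂ) • Z ∈ siegel d := by
  refine ⟨hZ.1.smul _, ?_⟩
  have : ((t : ℂ) • Z).map Complex.im = t • Z.map Complex.im := by
    ext i j
    simp
  rw [this]
  exact hZ.2.smul ht

theorem quadForm_smul (c : ℂ) (Z : CMat d) (u : Fin d → ℝ) :
    quadForm (c • Z) u = c * quadForm Z u := by
  simp [quadForm, Matrix.smul_mulVec, dotProduct_smul]

theorem quadForm_smul_vec (Z : CMat d) (c : ℝ) (u : Fin d → ℝ) :
    quadForm Z (c • u) = (c : ℂ) ^ 2 * quadForm Z u := by
  simp only [quadForm_eq_sum, Finset.mul_sum, Pi.smul_apply, smul_eq_mul, Complex.ofReal_mul]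
  exact Finset.sum_congr rfl fun i _ => Finset.sum_congr rfl fun j _ => by ring

/-- Substitute `u / √t` for `u`; the Jacobian is `√t ^ d`. -/
theorem gaussInt_smul (Z : CMat d) {t : ℝ} (ht : 0 < t) :
    gaussInt (((t⁻¹ : ℝ) : ℂ) • Z) = ((t ^ ((d : ℝ) / 2) : ℝ) : ℂ) * gaussInt Z := by
  have hs : 0 < Real.sqrt t := Real.sqrt_pos.mpr ht
  have h := Measure.integral_comp_inv_smul (volume : Measure (Fin d → ℝ))
    (fun u => Complex.exp (Complex.I * (quadForm Z u / 2))) (Real.sqrt t)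
  have h1 : ∀ u : Fin d → ℝ, quadForm Z ((Real.sqrt t)⁻¹ • u) =
      quadForm (((t⁻¹ : ℝ) : ℂ) • Z) u := by
    intro u
    rw [quadForm_smul_vec, quadForm_smul, ← Complex.ofReal_pow, inv_pow, Real.sq_sqrt ht.le]
  simp only [h1] at h
  rw [gaussInt, h, gaussInt, Complex.real_smul]
  congr 2
  rw [Module.finrank_fin_fun, abs_of_nonneg (by positivity), Real.sqrt_eq_rpow, ← Real.rpow_natCast,
    ← Real.rpow_mul ht.le]
  congr 1
  ring

theorem gaussInt_ne_zero {Z : CMat d} (hZ : Z ∈ siegel d) : gaussInt Z ≠ 0 := by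
  intro h
  have h1 := (gaussInt_spec hZ).2
  rcases Nat.eq_zero_or_pos d with rfl | hd
  · simp [h] at h1
  · rw [h] at h1
    have h2 : (2 * Real.pi : ℂ) ^ d ≠ 0 :=
      pow_ne_zero _ (mul_ne_zero two_ne_zero (Complex.ofReal_ne_zero.mpr Real.pi_ne_zero))
    exact h2 (by rw [← h1]; simp)

theorem norm_cexp_quadForm (Z : CMat d) (u : Fin d → ℝ) :
    ‖Complex.exp (Complex.I * (quadForm Z u / 2))‖ =
      Real.exp (-(u ⬝ᵥ (Z.map Complex.im) *ᵥ u) / 2) := by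
  rw [Complex.norm_exp, ← im_quadForm]
  congr 1
  have : quadForm Z u / 2 = ((1 / 2 : ℝ) : ℂ) * quadForm Z u := by push_cast; ring
  rw [this, Complex.I_mul_re, Complex.im_ofReal_mul]
  ring

theorem abs_dotProduct_mulVec_le {A : Matrix (Fin d) (Fin d) ℝ} {ε : ℝ}
    (hA : ∀ i j, |A i j| ≤ ε) (u : Fin d → ℝ) :
    |u ⬝ᵥ A *ᵥ u| ≤ ε * d * ∑ k, u k ^ 2 := by
  have h1 : u ⬝ᵥ A *ᵥ u = ∑ i, ∑ j, A i j * (u i * u j) := by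
    simp only [dotProduct, Matrix.mulVec, Finset.mul_sum]
    exact Finset.sum_congr rfl fun i _ => Finset.sum_congr rfl fun j _ => by ring
  have h2 : ∀ i j, |A i j * (u i * u j)| ≤ ε * ((u i ^ 2 + u j ^ 2) / 2) := fun i j => by
    rw [abs_mul]
    refine mul_le_mul (hA i j) ?_ (abs_nonneg _) ((abs_nonneg _).trans (hA i j))
    rw [abs_le]
    constructor <;> nlinarith [sq_nonneg (u i - u j), sq_nonneg (u i + u j)]
  calc |u ⬝ᵥ A *ᵥ u| ≤ ∑ i, ∑ j, ε * ((u i ^ 2 + u j ^ 2) / 2) := by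
        rw [h1]
        refine (Finset.abs_sum_le_sum_abs _ _).trans (Finset.sum_le_sum fun i _ => ?_)
        exact (Finset.abs_sum_le_sum_abs _ _).trans (Finset.sum_le_sum fun j _ => h2 i j)
    _ = ε * d * ∑ k, u k ^ 2 := by
        simp only [← Finset.mul_sum, ← Finset.sum_div, Finset.sum_add_distrib, Finset.sum_const,
          Finset.card_univ, Fintype.card_fin, nsmul_eq_mul]
        ring

theorem integrable_exp_neg_mul_sum_sq {c : ℝ} (hc : 0 < c) :
    Integrable fun u : Fin d → ℝ => Real.exp (-(c * ∑ k, u k ^ 2)) := by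
  have h := (GaussianFourier.integrable_cexp_neg_mul_sum_add (ι := Fin d) (b := (c : ℂ))
    (by simpa using hc) 0).norm
  refine h.congr (Filter.Eventually.of_forall fun u => ?_)
  simp only [Pi.zero_apply, zero_mul, Finset.sum_const_zero, add_zero, Complex.norm_exp]
  congr 1
  norm_cast
  ring

/-- Dominated convergence: the modulus of the integrand depends only on the imaginary part, which
stays uniformly positive definite near `Z₀`. -/
theorem continuousOn_gaussInt : ContinuousOn (gaussInt (d := d)) (siegel d) := by
  intro Z₀ hZ₀
  obtain ⟨c, hc, hcY⟩ := exists_lower_bound_of_posDef hZ₀.2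
  obtain ⟨ε, hε, hεd⟩ : ∃ ε : ℝ, 0 < ε ∧ ε * d ≤ c / 2 := by
    -- Entries perturbed by at most `ε` change the form by at most `ε d |u|² ≤ (c/2) |u|²`. A lower
    -- bound `(c/2) |u|²` survives, and the factor `1/2` in the exponent leaves the rate `c/4` of
    -- the majorant. The `d + 1` covers `d = 0`.
    refine ⟨c / (2 * (d + 1)), by positivity, ?_⟩
    rw [div_mul_eq_mul_div, div_le_div_iff₀ (by positivity) (by positivity)]
    nlinarith
  have hnear : ∀ᶠ Z in nhdsWithin Z₀ (siegel d), ∀ i j, |(Z i j).im - (Z₀ i j).im| ≤ ε := by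
    refine Filter.Eventually.filter_mono nhdsWithin_le_nhds ?_
    refine Filter.eventually_all.mpr fun i => Filter.eventually_all.mpr fun j => ?_
    have hcont : Continuous fun Z : CMat d => |(Z i j).im - (Z₀ i j).im| :=
      ((Complex.continuous_im.comp (continuous_id.matrix_elem i j)).sub continuous_const).abs
    have ht := hcont.tendsto Z₀
    simp only [sub_self, abs_zero] at ht
    exact ht.eventually (eventually_le_nhds hε)
  have : FirstCountableTopology (CMat d) :=
    inferInstanceAs (FirstCountableTopology (Fin d → Fin d → ℂ))
  refine continuousWithinAt_of_dominated
    (bound := fun u : Fin d → ℝ => Real.exp (-(c / 4 * ∑ k, u k ^ 2))) ?_ ?_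
    (integrable_exp_neg_mul_sum_sq (by positivity)) ?_
  · refine Filter.Eventually.of_forall fun Z => Continuous.aestronglyMeasurable ?_
    have := continuous_quadForm Z
    fun_prop
  · filter_upwards [hnear] with Z hZ
    refine Filter.Eventually.of_forall fun u => ?_
    rw [norm_cexp_quadForm, Real.exp_le_exp]
    have h1 := hcY u
    have h2 := abs_dotProduct_mulVec_le (A := Z.map Complex.im - Z₀.map Complex.im)
      (ε := ε) (fun i j => hZ i j) u
    rw [Matrix.sub_mulVec, dotProduct_sub] at h2
    have h3 := (abs_le.mp h2).1
    have h4 : 0 ≤ ∑ k, u k ^ 2 := Finset.sum_nonneg fun k _ => sq_nonneg _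
    have h5 := mul_le_mul_of_nonneg_right hεd h4
    linarith
  · refine Filter.Eventually.of_forall fun u => Continuous.continuousWithinAt ?_
    simp only [quadForm_eq_sum]
    have : ∀ i j, Continuous fun Z : CMat d => Z i j := fun i j =>
      continuous_id.matrix_elem i j
    fun_prop

/-- The branch of `(det Z)^{1/2}` on the Siegel upper half space with value `i^{d/2}` at `i I`. -/
noncomputable def sqrtDet (Z : CMat d) : ℂ :=
  Complex.I ^ ((d : ℂ) / 2) * (((2 * Real.pi) ^ ((d : ℝ) / 2) : ℝ) : ℂ) / gaussInt Z

theorem continuousOn_sqrtDet : ContinuousOn (sqrtDet (d := d)) (siegel d) :=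
  continuousOn_const.div continuousOn_gaussInt fun _ hZ => gaussInt_ne_zero hZ

theorem I_cpow_half_sq : (Complex.I ^ ((d : ℂ) / 2)) ^ 2 = Complex.I ^ d := by
  rw [← Complex.cpow_nat_mul, ← Complex.cpow_natCast]
  congr 1
  push_cast
  ring

theorem two_pi_rpow_half_sq :
    ((((2 * Real.pi) ^ ((d : ℝ) / 2) : ℝ) : ℂ)) ^ 2 = (2 * Real.pi : ℂ) ^ d := by
  rw [← Complex.ofReal_pow, ← Real.rpow_natCast, ← Real.rpow_mul (by positivity)]
  have : (d : ℝ) / 2 * ((2 : ℕ) : ℝ) = (d : ℝ) := by push_cast; ring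
  rw [this, Real.rpow_natCast]
  push_cast
  rfl

theorem sqrtDet_sq {Z : CMat d} (hZ : Z ∈ siegel d) : sqrtDet Z ^ 2 = Z.det := by
  have h := (gaussInt_spec hZ).2
  have h0 := gaussInt_ne_zero hZ
  rw [Matrix.det_smul, Fintype.card_fin] at h
  rw [sqrtDet, div_pow, mul_pow, I_cpow_half_sq, two_pi_rpow_half_sq, ← h,
    div_eq_iff (pow_ne_zero _ h0)]
  have hI : Complex.I ^ d * (-Complex.I) ^ d = 1 := by
    rw [← mul_pow]
    simp
  linear_combination (gaussInt Z ^ 2 * Z.det) * hI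

theorem gaussInt_I_smul_one :
    gaussInt (Complex.I • (1 : CMat d)) = (((2 * Real.pi) ^ ((d : ℝ) / 2) : ℝ) : ℂ) := by
  have h := GaussianFourier.integral_cexp_neg_mul_sum_add (ι := Fin d) (b := (1 / 2 : ℂ))
    (by norm_num) 0
  have h1 : ∀ u : Fin d → ℝ, Complex.I * (quadForm (Complex.I • (1 : CMat d)) u / 2) =
      -(1 / 2 : ℂ) * ∑ k, (u k : ℂ) ^ 2 + ∑ k, (0 : Fin d → ℂ) k * u k := by
    intro u
    rw [quadForm_smul, ← Matrix.diagonal_one, quadForm_diagonal]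
    simp only [Pi.zero_apply, zero_mul, Finset.sum_const_zero, add_zero, one_mul]
    linear_combination (1 / 2 * ∑ k, (u k : ℂ) ^ 2) * Complex.I_sq
  rw [gaussInt]
  simp only [h1]
  rw [h, Complex.ofReal_cpow (by positivity)]
  simp
  congr 1
  ring

theorem sqrtDet_I_smul_one :
    sqrtDet (Complex.I • (1 : CMat d)) = Complex.I ^ ((d : ℂ) / 2) := by
  rw [sqrtDet, gaussInt_I_smul_one]
  refine mul_div_cancel_right₀ _ (Complex.ofReal_ne_zero.mpr ?_)
  positivity

end

/-! ### The ground state and its Fourier transform -/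

section

variable {d : ℕ} {ħ : ℝ} {Q P : CMat d}

/-- This is `gaussInt_spec` for the matrix `ħ⁻¹ Z` and the vector `ħ⁻¹ w`. The inverse matrix is `ħ
Z⁻¹`, so the dual exponent scales as `ħ · ħ⁻² = ħ⁻¹`. -/
theorem integral_cexp_quadForm_sub {Z : CMat d} (hZ : Z ∈ siegel d) (hħ : 0 < ħ)
    (w : Fin d → ℝ) :
    ∫ u : Fin d → ℝ, Complex.exp (Complex.I / ħ * (1 / 2 * quadForm Z u
        - ∑ k, (w k : ℂ) * u k)) =
      ((ħ ^ ((d : ℝ) / 2) : ℝ) : ℂ) * gaussInt Z *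
        Complex.exp (-(Complex.I / ħ) * (1 / 2 * quadForm Z⁻¹ w)) := by
  have hħ' : (ħ : ℂ) ≠ 0 := Complex.ofReal_ne_zero.mpr hħ.ne'
  have h := (gaussInt_spec (smul_mem_siegel hZ (inv_pos.mpr hħ))).1 (ħ⁻¹ • w)
  rw [gaussInt_smul Z hħ] at h
  have hdet : IsUnit Z.det := by
    rw [← sqrtDet_sq hZ]
    refine (pow_ne_zero _ ?_).isUnit
    refine div_ne_zero (mul_ne_zero ?_ ?_) (gaussInt_ne_zero hZ)
    · simp [Complex.cpow_eq_zero_iff]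
    · exact Complex.ofReal_ne_zero.mpr (by positivity)
  have hinv : (((ħ⁻¹ : ℝ) : ℂ) • Z)⁻¹ = (ħ : ℂ) • Z⁻¹ := by
    refine Matrix.inv_eq_right_inv ?_
    rw [Matrix.smul_mul, Matrix.mul_smul, Matrix.mul_nonsing_inv _ hdet, smul_smul]
    simp [hħ']
  rw [hinv, quadForm_smul, quadForm_smul_vec] at h
  refine Eq.trans (integral_congr_ae (Filter.Eventually.of_forall fun u => ?_)) (h.trans ?_)
  · simp only [quadForm_smul, Pi.smul_apply, smul_eq_mul]
    congr 1
    rw [mul_sub, mul_sub, Finset.mul_sum, Finset.mul_sum]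
    congr 1
    · push_cast; ring
    · exact Finset.sum_congr rfl fun k _ => by push_cast; ring
  · congr 2
    push_cast
    field_simp

open scoped ComplexOrder in
theorem star_dotProduct_self_eq_zero {v : Fin d → ℂ} (h : star v ⬝ᵥ v = 0) : v = 0 :=
  dotProduct_star_self_eq_zero.mp h

theorem isUnit_det_of_mulVec_injective {A : CMat d} (h : ∀ v, A *ᵥ v = 0 → v = 0) :
    IsUnit A.det := by
  rw [← Matrix.isUnit_iff_isUnit_det, ← Matrix.mulVec_injective_iff_isUnit]
  exact (injective_iff_map_eq_zero (Matrix.mulVecLin A)).mpr h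

/-- Evaluating the second relation at `v` gives both the invertibility of `Q` and `P` (if `Q v = 0`
or `P v = 0`, the left side vanishes, so `v = 0`) and the positivity of the imaginary part of `P
Q⁻¹`. -/
theorem star_mulVec_dotProduct_sub
    (h2 : Qᴴ * P - Pᴴ * Q = (2 * Complex.I) • (1 : CMat d)) (v : Fin d → ℂ) :
    star (Q *ᵥ v) ⬝ᵥ P *ᵥ v - star (P *ᵥ v) ⬝ᵥ Q *ᵥ v = 2 * Complex.I * (star v ⬝ᵥ v) := by
  have h := congrArg (fun A => star v ⬝ᵥ A *ᵥ v) h2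
  simp only [Matrix.sub_mulVec, dotProduct_sub, Matrix.smul_mulVec, dotProduct_smul,
    Matrix.one_mulVec, smul_eq_mul] at h
  rw [← h, Matrix.star_mulVec, Matrix.star_mulVec, ← Matrix.dotProduct_mulVec,
    ← Matrix.dotProduct_mulVec, Matrix.mulVec_mulVec, Matrix.mulVec_mulVec]

theorem isUnit_det_Q (h2 : Qᴴ * P - Pᴴ * Q = (2 * Complex.I) • (1 : CMat d)) :
    IsUnit Q.det := by
  refine isUnit_det_of_mulVec_injective fun v hv => star_dotProduct_self_eq_zero ?_
  simpa [hv] using star_mulVec_dotProduct_sub h2 v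

theorem isUnit_det_P (h2 : Qᴴ * P - Pᴴ * Q = (2 * Complex.I) • (1 : CMat d)) :
    IsUnit P.det := by
  refine isUnit_det_of_mulVec_injective fun v hv => star_dotProduct_self_eq_zero ?_
  simpa [hv] using star_mulVec_dotProduct_sub h2 v

theorem isSymm_mul_inv (h1 : Qᵀ * P - Pᵀ * Q = 0) (hQ : IsUnit Q.det) :
    (P * Q⁻¹).IsSymm := by
  have hQt : IsUnit Qᵀ.det := by rwa [Matrix.det_transpose]
  rw [Matrix.IsSymm, Matrix.transpose_mul, Matrix.transpose_nonsing_inv]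
  calc Qᵀ⁻¹ * Pᵀ = Qᵀ⁻¹ * (Pᵀ * Q) * Q⁻¹ := by
        rw [Matrix.mul_assoc, Matrix.mul_assoc, Matrix.mul_nonsing_inv _ hQ, Matrix.mul_one]
    _ = Qᵀ⁻¹ * (Qᵀ * P) * Q⁻¹ := by rw [sub_eq_zero.mp h1]
    _ = P * Q⁻¹ := by rw [Matrix.nonsing_inv_mul_cancel_left _ _ hQt]

open scoped ComplexOrder in
-- For real `u` and `v = Q⁻¹ u` the evaluated relation says that `uᵀ Z u` minus its conjugate is `2i
-- |v|²`. Hence the imaginary part of `uᵀ Z u` is `|v|²`.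
theorem mul_inv_mem_siegel (h1 : Qᵀ * P - Pᵀ * Q = 0)
    (h2 : Qᴴ * P - Pᴴ * Q = (2 * Complex.I) • (1 : CMat d)) : P * Q⁻¹ ∈ siegel d := by
  have hQ := isUnit_det_Q h2
  have hs := isSymm_mul_inv h1 hQ
  refine ⟨hs, Matrix.PosDef.of_dotProduct_mulVec_pos ?_ fun u hu => ?_⟩
  · rw [Matrix.IsHermitian, Matrix.conjTranspose_eq_transpose_of_trivial, ← Matrix.transpose_map,
      hs.eq]
  · set uc : Fin d → ℂ := fun k => (u k : ℂ) with huc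
    set v := Q⁻¹ *ᵥ uc with hv
    have hQv : Q *ᵥ v = uc := by
      rw [hv, Matrix.mulVec_mulVec, Matrix.mul_nonsing_inv _ hQ, Matrix.one_mulVec]
    have hPv : P *ᵥ v = (P * Q⁻¹) *ᵥ uc := by rw [hv, Matrix.mulVec_mulVec]
    have h := star_mulVec_dotProduct_sub h2 v
    have hstar : star uc = uc := by ext k; simp [huc]
    have hsw : star ((P * Q⁻¹) *ᵥ uc) ⬝ᵥ uc = star (quadForm (P * Q⁻¹) u) := by
      rw [quadForm, ← huc, Matrix.star_dotProduct, hstar]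
    have hv0 : v ≠ 0 := by
      intro h0
      apply hu
      ext k
      have := congrFun hQv k
      rw [h0, Matrix.mulVec_zero] at this
      exact Complex.ofReal_eq_zero.mp this.symm
    have hpos : 0 < (star v ⬝ᵥ v).re := by
      have := (Matrix.dotProduct_star_self_pos_iff (v := v)).mpr hv0
      exact (Complex.lt_def.mp this).1
    rw [hQv, hPv, hstar, hsw, ← quadForm] at h
    have him := congrArg Complex.im h
    have hr : (star v ⬝ᵥ v).im = 0 := by
      rw [dotProduct, Complex.im_sum]
      refine Finset.sum_eq_zero fun k _ => ?_
      simp [mul_comm]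
    simp at him
    rw [star_trivial, ← im_quadForm]
    linarith

theorem semiFourier_groundState (hħ : 0 < ħ) (h1 : Qᵀ * P - Pᵀ * Q = 0)
    (h2 : Qᴴ * P - Pᴴ * Q = (2 * Complex.I) • (1 : CMat d)) (r : ℂ) (q p : Fin d → ℝ) :
    semiFourier ħ (groundState ħ Q P r q p) =
      (Complex.I ^ ((d : ℂ) / 2) * Complex.exp (-(Complex.I / ħ) * (∑ k, p k * q k : ℝ))) •
        groundState ħ P (-Q) (r * sqrtDet (P * Q⁻¹)) p (-q) := by
  have hZ := mul_inv_mem_siegel h1 h2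
  have hP := isUnit_det_P h2
  have hQ := isUnit_det_Q h2
  set Z := P * Q⁻¹ with hZdef
  have hinv : Z⁻¹ = Q * P⁻¹ := by
    rw [hZdef, Matrix.mul_inv_rev, Matrix.nonsing_inv_nonsing_inv _ hQ]
  have hnegZ : -Q * P⁻¹ = -Z⁻¹ := by rw [hinv, Matrix.neg_mul]
  ext x
  set w : Fin d → ℝ := fun k => x k - p k with hw
  have hint : ∫ y : Space d, Complex.exp (-(Complex.I / ħ) * (∑ k, x k * y k : ℝ)) *
      groundState ħ Q P r q p y =
      r⁻¹ / (((Real.pi * ħ) ^ ((d : ℝ) / 4) : ℝ) : ℂ) *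
        Complex.exp (-(Complex.I / ħ) * (∑ k, x k * q k : ℝ)) *
        (((ħ ^ ((d : ℝ) / 2) : ℝ) : ℂ) * gaussInt Z *
        Complex.exp (-(Complex.I / ħ) * (1 / 2 * quadForm Z⁻¹ w))) := by
    rw [← integral_cexp_quadForm_sub hZ hħ, ← integral_const_mul,
      ← (PiLp.volume_preserving_toLp (Fin d)).integral_comp
        (MeasurableEquiv.toLp 2 _).measurableEmbedding,
      ← integral_add_right_eq_self _ q]
    refine integral_congr_ae (Filter.Eventually.of_forall fun u => ?_)
    simp only [groundState, Pi.add_apply, add_sub_cancel_right]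
    rw [← quadForm, ← hZdef]
    rw [mul_left_comm, ← Complex.exp_add, mul_assoc, ← Complex.exp_add]
    congr 2
    -- After the shift `y = u + q`, writing `x = w + p` makes the phase `p·u` of the ground state
    -- cancel. What remains is a Gaussian transform at `w = x - p` times the constant phase of
    -- `x·q`.
    have hs : (∑ k, x k * (u k + q k) : ℝ) = ∑ k, x k * q k + ∑ k, w k * u k + ∑ k, p k * u k := by
      rw [← Finset.sum_add_distrib, ← Finset.sum_add_distrib]
      exact Finset.sum_congr rfl fun k _ => by rw [hw]; ring
    rw [hs]
    push_cast
    ring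
  rw [semiFourier, hint, Pi.smul_apply, smul_eq_mul, groundState, ← quadForm, hnegZ]
  have hneg : quadForm (-Z⁻¹) w = -quadForm Z⁻¹ w := by
    simpa using quadForm_smul (-1) Z⁻¹ w
  have hsum : (∑ k, (-q) k * (x k - p k) : ℝ) = ∑ k, p k * q k - ∑ k, x k * q k := by
    rw [← Finset.sum_sub_distrib]
    exact Finset.sum_congr rfl fun k _ => by rw [Pi.neg_apply]; ring
  have hexp : Complex.exp (-(Complex.I / ħ) * (∑ k, p k * q k : ℝ)) *
      Complex.exp (Complex.I / ħ * (1 / 2 * quadForm (-Z⁻¹) w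
        + ((∑ k, (-q) k * (x k - p k) : ℝ) : ℂ))) =
      Complex.exp (-(Complex.I / ħ) * (∑ k, x k * q k : ℝ)) *
        Complex.exp (-(Complex.I / ħ) * (1 / 2 * quadForm Z⁻¹ w)) := by
    rw [← Complex.exp_add, ← Complex.exp_add, hneg, hsum]
    congr 1
    push_cast
    ring
  have hI : Complex.I ^ ((d : ℂ) / 2) ≠ 0 := by simp [Complex.cpow_eq_zero_iff]
  -- The definition of `sqrtDet`, rearranged: it absorbs the prefactor exactly, up to the phase
  -- `i^{d/2}`.
  have hs : Complex.I ^ ((d : ℂ) / 2) * (sqrtDet Z)⁻¹ =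
      (((2 * Real.pi * ħ) ^ ((d : ℝ) / 2) : ℝ) : ℂ)⁻¹ * (((ħ ^ ((d : ℝ) / 2) : ℝ) : ℂ) *
        gaussInt Z) := by
    have h3 : (((ħ ^ ((d : ℝ) / 2) : ℝ) : ℂ)) ≠ 0 := Complex.ofReal_ne_zero.mpr (by positivity)
    have h4 : ((((2 * Real.pi) ^ ((d : ℝ) / 2) : ℝ) : ℂ)) ≠ 0 :=
      Complex.ofReal_ne_zero.mpr (by positivity)
    rw [sqrtDet, Real.mul_rpow (by positivity) hħ.le, Complex.ofReal_mul]
    field_simp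
  calc _ = r⁻¹ / (((Real.pi * ħ) ^ ((d : ℝ) / 4) : ℝ) : ℂ) *
        ((((2 * Real.pi * ħ) ^ ((d : ℝ) / 2) : ℝ) : ℂ)⁻¹ * (((ħ ^ ((d : ℝ) / 2) : ℝ) : ℂ) *
        gaussInt Z)) * (Complex.exp (-(Complex.I / ħ) * (∑ k, x k * q k : ℝ)) *
        Complex.exp (-(Complex.I / ħ) * (1 / 2 * quadForm Z⁻¹ w))) := by ring
    _ = _ := by
      rw [← hs, ← hexp, mul_inv]
      ring

end

/-! ### The Fourier transform of derivatives and coordinate multiples -/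

section

variable {d : ℕ} {ħ : ℝ}

section Fourier

/-- The kernel `e^{-(i/ħ) x·y}`. -/
noncomputable def fourierKernel (ħ : ℝ) (x y : Space d) : ℂ :=
  Complex.exp (-(Complex.I / ħ) * (∑ k, x k * y k : ℝ))

theorem semiFourier_eq (ħ : ℝ) (f : Space d → ℂ) (x : Space d) :
    semiFourier ħ f x = (((2 * Real.pi * ħ) ^ ((d : ℝ) / 2) : ℝ) : ℂ)⁻¹ *
      ∫ y, fourierKernel ħ x y * f y := rfl

theorem fourierKernel_comm (x y : Space d) : fourierKernel ħ x y = fourierKernel ħ y x := by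
  simp only [fourierKernel, mul_comm]

theorem norm_fourierKernel (x y : Space d) : ‖fourierKernel ħ x y‖ = 1 := by
  have : -(Complex.I / ħ) * ((∑ k, x k * y k : ℝ) : ℂ) =
      ((-(∑ k, x k * y k) / ħ : ℝ) : ℂ) * Complex.I := by
    push_cast; ring
  rw [fourierKernel, this, Complex.norm_exp_ofReal_mul_I]

/-- The linear form `x ↦ x·y`. -/
noncomputable def pairing (y : Space d) : Space d →L[ℝ] ℂ :=
  Complex.ofRealCLM.comp (∑ k, y k • (EuclideanSpace.proj k : Space d →L[ℝ] ℝ))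

theorem pairing_apply (x y : Space d) : pairing y x = ((∑ k, x k * y k : ℝ) : ℂ) := by
  simp [pairing, mul_comm]

theorem pairing_single (y : Space d) (k : Fin d) :
    pairing y (EuclideanSpace.single k 1) = (y k : ℂ) := by
  rw [pairing_apply, Finset.sum_eq_single k]
  · simp
  · intro j _ hj
    simp [hj]
  · simp

theorem hasFDerivAt_fourierKernel (x y : Space d) :
    HasFDerivAt (fun x => fourierKernel ħ x y)
      (fourierKernel ħ x y • (-(Complex.I / ħ)) • pairing y) x := by
  have h := (((pairing y).hasFDerivAt (x := x)).const_mul (-(Complex.I / ħ))).cexp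
  have e : ∀ x, fourierKernel ħ x y = Complex.exp (-(Complex.I / ħ) * pairing y x) := fun x => by
    rw [pairing_apply, fourierKernel]
  simp only [e]
  exact h

theorem contDiff_fourierKernel (x : Space d) : ContDiff ℝ ∞ (fourierKernel ħ x) := by
  have h : fourierKernel ħ x = fun y => Complex.exp (-(Complex.I / ħ) * pairing x y) := by
    ext y
    rw [fourierKernel_comm, pairing_apply, fourierKernel]
  rw [h]
  exact (contDiff_const.mul (pairing x).contDiff).cexp

theorem integrable_fourierKernel_mul {f : Space d → ℂ} (hf : Integrable f) (x : Space d) :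
    Integrable fun y => fourierKernel ħ x y * f y := by
  refine hf.mono ((contDiff_fourierKernel x).continuous.aestronglyMeasurable.mul hf.1) ?_
  exact Filter.Eventually.of_forall fun y => by rw [norm_mul, norm_fourierKernel, one_mul]

theorem semiFourier_add {f g : Space d → ℂ} (hf : Integrable f) (hg : Integrable g) :
    semiFourier ħ (fun x => f x + g x) = fun x => semiFourier ħ f x + semiFourier ħ g x := by
  ext x
  simp only [semiFourier_eq, mul_add]
  rw [integral_add (integrable_fourierKernel_mul hf x) (integrable_fourierKernel_mul hg x),
    mul_add]

theorem semiFourier_const_mul (c : ℂ) (f : Space d → ℂ) :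
    semiFourier ħ (fun x => c * f x) = fun x => c * semiFourier ħ f x := by
  ext x
  simp only [semiFourier_eq, mul_left_comm _ c]
  rw [integral_const_mul, mul_left_comm]

theorem semiFourier_sum {ι : Type*} (s : Finset ι) {f : ι → Space d → ℂ}
    (hf : ∀ i ∈ s, Integrable (f i)) :
    semiFourier ħ (fun x => ∑ i ∈ s, f i x) = fun x => ∑ i ∈ s, semiFourier ħ (f i) x := by
  ext x
  simp only [semiFourier_eq, Finset.mul_sum]
  rw [integral_finsetSum _ fun i hi => integrable_fourierKernel_mul (hf i hi) x, Finset.mul_sum]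

/-- The Fourier transform turns partial derivatives into multiplication by coordinates. -/
theorem semiFourier_partial {f : Space d → ℂ} (hf : Integrable f) (hd : Differentiable ℝ f)
    (k : Fin d) (hk : Integrable fun x => fderiv ℝ f x (EuclideanSpace.single k 1))
    (x : Space d) :
    semiFourier ħ (fun y => fderiv ℝ f y (EuclideanSpace.single k 1)) x =
      Complex.I / ħ * (x k : ℂ) * semiFourier ħ f x := by
  have he : ∀ y, fderiv ℝ (fourierKernel ħ x) y (EuclideanSpace.single k 1) =
      -(Complex.I / ħ * (x k : ℂ)) * fourierKernel ħ x y := by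
    intro y
    have h := (hasFDerivAt_fourierKernel (ħ := ħ) y x).fderiv
    have h' : (fun z => fourierKernel ħ z x) = fourierKernel ħ x :=
      funext fun z => fourierKernel_comm z x
    rw [h'] at h
    rw [h, fourierKernel_comm y x]
    simp only [smul_apply, pairing_single, smul_eq_mul]
    ring
  have hi := integrable_fourierKernel_mul (ħ := ħ) hf x
  -- Integration by parts against the kernel. Integrability of the three products replaces the
  -- vanishing of boundary terms.
  have h := integral_mul_fderiv_eq_neg_fderiv_mul_of_integrable (μ := volume)
    (f := fourierKernel ħ x) (g := f) (v := EuclideanSpace.single k 1)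
    (by simpa only [he, mul_assoc] using hi.const_mul (-(Complex.I / ħ * (x k : ℂ))))
    (integrable_fourierKernel_mul hk x) hi
    (fun y _ => (contDiff_fourierKernel x).differentiable (by simp) y) (fun y _ => hd y)
  rw [semiFourier_eq, h, semiFourier_eq]
  simp only [he, mul_assoc]
  rw [integral_const_mul]
  ring

theorem pairing_eq_sum (y : Space d) : pairing y =
    ∑ j, y j • Complex.ofRealCLM.comp (EuclideanSpace.proj j : Space d →L[ℝ] ℝ) := by
  ext v
  simp [pairing]

theorem continuous_pairing : Continuous fun y : Space d => pairing y := by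
  simp only [pairing_eq_sum]
  fun_prop

theorem norm_pairing_mul_le (y : Space d) (c : ℂ) : ‖pairing y‖ * ‖c‖ ≤ ∑ j, ‖(y j : ℂ) * c‖ *
    ‖Complex.ofRealCLM.comp (EuclideanSpace.proj j : Space d →L[ℝ] ℝ)‖ := by
  have h : ‖pairing y‖ ≤ ∑ j, ‖(y j : ℂ)‖ *
      ‖Complex.ofRealCLM.comp (EuclideanSpace.proj j : Space d →L[ℝ] ℝ)‖ := by
    rw [pairing_eq_sum]
    refine (norm_sum_le _ _).trans (Finset.sum_le_sum fun j _ => ?_)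
    rw [norm_smul, Complex.norm_real]
  refine (mul_le_mul_of_nonneg_right h (norm_nonneg c)).trans (le_of_eq ?_)
  rw [Finset.sum_mul]
  exact Finset.sum_congr rfl fun j _ => by rw [norm_mul]; ring

/-- The kernel has modulus 1, so the bound is independent of `x` and serves as majorant for
differentiation under the integral sign. -/
theorem norm_kernel_deriv_le (f : Space d → ℂ) (x y : Space d) :
    ‖f y • fourierKernel ħ x y • (-(Complex.I / ħ)) • pairing y‖ ≤
      ‖Complex.I / (ħ : ℂ)‖ * ∑ j, ‖(y j : ℂ) * f y‖ *
        ‖Complex.ofRealCLM.comp (EuclideanSpace.proj j : Space d →L[ℝ] ℝ)‖ := by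
  rw [norm_smul, norm_smul, norm_smul, norm_fourierKernel, one_mul, norm_neg, mul_left_comm,
    mul_comm ‖f y‖]
  exact mul_le_mul_of_nonneg_left (norm_pairing_mul_le y (f y)) (norm_nonneg _)

theorem aestronglyMeasurable_kernel_deriv {f : Space d → ℂ} (hf : Integrable f) (x : Space d) :
    AEStronglyMeasurable
      (fun y => f y • fourierKernel ħ x y • (-(Complex.I / (ħ : ℂ))) • pairing y) volume := by
  have h' : Continuous fun y : Space d => (-(Complex.I / (ħ : ℂ))) • pairing y :=
    (continuous_const_smul _).comp continuous_pairing
  have h : Continuous fun y => fourierKernel ħ x y • (-(Complex.I / (ħ : ℂ))) • pairing y :=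
    (contDiff_fourierKernel x).continuous.smul h'
  exact hf.1.smul h.aestronglyMeasurable

theorem hasFDerivAt_integral_fourierKernel {f : Space d → ℂ} (hf : Integrable f)
    (hk : ∀ k : Fin d, Integrable fun x : Space d => (x k : ℂ) * f x) (x : Space d) :
    Integrable (fun y => f y • fourierKernel ħ x y • (-(Complex.I / (ħ : ℂ))) • pairing y) ∧
    HasFDerivAt (fun x => ∫ y, fourierKernel ħ x y * f y)
      (∫ y, f y • fourierKernel ħ x y • (-(Complex.I / (ħ : ℂ))) • pairing y) x := by
  have hbi : Integrable fun y : Space d => ‖Complex.I / (ħ : ℂ)‖ * ∑ j, ‖(y j : ℂ) * f y‖ *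
      ‖Complex.ofRealCLM.comp (EuclideanSpace.proj j : Space d →L[ℝ] ℝ)‖ :=
    (integrable_finsetSum _ fun j _ => (hk j).norm.mul_const _).const_mul _
  refine ⟨hbi.mono' (aestronglyMeasurable_kernel_deriv hf x)
    (Filter.Eventually.of_forall fun y => norm_kernel_deriv_le f x y), ?_⟩
  exact hasFDerivAt_integral_of_dominated_of_fderiv_le (s := Set.univ) Filter.univ_mem
    (Filter.Eventually.of_forall fun z => (integrable_fourierKernel_mul hf z).1)
    (integrable_fourierKernel_mul hf x) (aestronglyMeasurable_kernel_deriv hf x)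
    (Filter.Eventually.of_forall fun y z _ => norm_kernel_deriv_le f z y) hbi
    (Filter.Eventually.of_forall fun y z _ => (hasFDerivAt_fourierKernel z y).mul_const (f y))

/-- The Fourier transform turns multiplication by coordinates into partial derivatives. -/
theorem partial_semiFourier {f : Space d → ℂ} (hf : Integrable f)
    (hk : ∀ k : Fin d, Integrable fun x : Space d => (x k : ℂ) * f x) (k : Fin d) (x : Space d) :
    fderiv ℝ (semiFourier ħ f) x (EuclideanSpace.single k 1) =
      -(Complex.I / ħ) * semiFourier ħ (fun y => (y k : ℂ) * f y) x := by
  obtain ⟨hi, hder⟩ := hasFDerivAt_integral_fourierKernel (ħ := ħ) hf hk x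
  have e : semiFourier ħ f = fun x => (((2 * Real.pi * ħ) ^ ((d : ℝ) / 2) : ℝ) : ℂ)⁻¹ *
      ∫ y, fourierKernel ħ x y * f y := rfl
  have h := hder.const_mul ((((2 * Real.pi * ħ) ^ ((d : ℝ) / 2) : ℝ) : ℂ)⁻¹)
  rw [e, h.fderiv, smul_apply, smul_eq_mul,
    ContinuousLinearMap.integral_apply hi, semiFourier_eq, mul_left_comm]
  congr 1
  rw [← integral_const_mul]
  congr 1
  funext y
  simp only [smul_apply, smul_eq_mul, pairing_single]
  ring

/-- The Fourier transform intertwines the raising operators. -/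
theorem semiFourier_raising (hħ : 0 < ħ) {Q P : CMat d} {q p : Fin d → ℝ} {f : Space d → ℂ}
    (hf : Integrable f) (hd : Differentiable ℝ f)
    (hx : ∀ k : Fin d, Integrable fun x : Space d => (x k : ℂ) * f x)
    (hp : ∀ k : Fin d, Integrable fun x => fderiv ℝ f x (EuclideanSpace.single k 1))
    (j : Fin d) :
    semiFourier ħ (raising ħ Q P q p j f) = raising ħ P (-Q) p (-q) j (semiFourier ħ f) := by
  have hħ' : (ħ : ℂ) ≠ 0 := Complex.ofReal_ne_zero.mpr hħ.ne'
  have h : raising ħ Q P q p j f = fun x => Complex.I / (Real.sqrt (2 * ħ) : ℂ) *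
      ∑ k, ((Pᴴ j k * ((x k : ℂ) * f x) + (Qᴴ j k * p k - Pᴴ j k * q k) * f x)
        + Complex.I * ħ * Qᴴ j k * fderiv ℝ f x (EuclideanSpace.single k 1)) := by
    ext x
    rw [raising_eq, Finset.sum_mul, Finset.mul_sum, ← Finset.sum_add_distrib]
    congr 1
    exact Finset.sum_congr rfl fun k _ => by ring
  have i1 := fun k => (hx k).const_mul (Pᴴ j k)
  have i2 := fun k => hf.const_mul (Qᴴ j k * p k - Pᴴ j k * q k)
  have i3 := fun k => (hp k).const_mul (Complex.I * ħ * Qᴴ j k)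
  have i12 : ∀ k, Integrable fun x : Space d =>
      Pᴴ j k * ((x k : ℂ) * f x) + (Qᴴ j k * p k - Pᴴ j k * q k) * f x := fun k =>
    (i1 k).add (i2 k)
  have i123 : ∀ k ∈ Finset.univ, Integrable fun x : Space d =>
      Pᴴ j k * ((x k : ℂ) * f x) + (Qᴴ j k * p k - Pᴴ j k * q k) * f x
        + Complex.I * ħ * Qᴴ j k * fderiv ℝ f x (EuclideanSpace.single k 1) := fun k _ =>
    (i12 k).add (i3 k)
  rw [h, semiFourier_const_mul, semiFourier_sum _ i123]
  ext x
  rw [raising_eq]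
  congr 1
  rw [Finset.sum_mul, Finset.mul_sum, ← Finset.sum_add_distrib]
  refine Finset.sum_congr rfl fun k _ => ?_
  -- Term by term, the `P^*` coefficients move from the coordinate to the derivative and the `Q^*`
  -- coefficients from the derivative to the coordinate. The scalar terms already agree with those
  -- of `(P, -Q, p, -q)`.
  rw [semiFourier_add (i12 k) (i3 k), semiFourier_add (i1 k) (i2 k)]
  simp only [semiFourier_const_mul]
  rw [semiFourier_partial hf hd k (hp k), partial_semiFourier hf hx]
  simp only [Matrix.conjTranspose_neg, Matrix.neg_apply, Pi.neg_apply, Complex.ofReal_neg]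
  field_simp
  linear_combination (Pᴴ j k * semiFourier ħ (fun y => (y k : ℂ) * f y) x
    + Qᴴ j k * x k * semiFourier ħ f x) * Complex.I_sq

end Fourier

end

/-! ### Polynomials times the ground state, and the wave packets -/

section

variable {d : ℕ} {ħ : ℝ} {Q P : CMat d} {r : ℂ} {q p : Fin d → ℝ}

/-- The products of `g` with polynomials in the coordinates. -/
inductive PolyMul (g : Space d → ℂ) : (Space d → ℂ) → Prop
  | base : PolyMul g g
  | coord (k : Fin d) {f : Space d → ℂ} : PolyMul g f → PolyMul g fun x => (x k : ℂ) * f x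
  | add {f₁ f₂ : Space d → ℂ} : PolyMul g f₁ → PolyMul g f₂ → PolyMul g fun x => f₁ x + f₂ x
  | const_mul (c : ℂ) {f : Space d → ℂ} : PolyMul g f → PolyMul g fun x => c * f x

namespace PolyMul

variable {g f : Space d → ℂ}

theorem congr {f' : Space d → ℂ} (hf : PolyMul g f) (h : ∀ x, f x = f' x) : PolyMul g f' :=
  funext h ▸ hf

theorem sum {ι : Type*} (s : Finset ι) {F : ι → Space d → ℂ} (h : ∀ i ∈ s, PolyMul g (F i)) :
    PolyMul g fun x => ∑ i ∈ s, F i x := by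
  classical
  induction s using Finset.induction_on with
  | empty => simpa using PolyMul.const_mul 0 PolyMul.base
  | insert a s ha ih =>
    simp only [Finset.sum_insert ha]
    exact (h a (Finset.mem_insert_self _ _)).add
      (ih fun i hi => h i (Finset.mem_insert_of_mem hi))

theorem coord_sub (k : Fin d) (c : ℝ) (hf : PolyMul g f) :
    PolyMul g fun x => ((x k - c : ℝ) : ℂ) * f x := by
  have h := (hf.coord k).add (hf.const_mul (-(c : ℂ)))
  refine h.congr fun x => ?_
  push_cast
  ring

theorem contDiff (hg : ContDiff ℝ ∞ g) (hf : PolyMul g f) : ContDiff ℝ ∞ f := by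
  induction hf with
  | base => exact hg
  | coord k _ ih =>
    exact (Complex.ofRealCLM.comp (EuclideanSpace.proj k : Space d →L[ℝ] ℝ)).contDiff.mul ih
  | add _ _ ih₁ ih₂ => exact ih₁.add ih₂
  | const_mul c _ ih => exact contDiff_const.mul ih

/-- By the Leibniz rule, the class is closed under `∂_l` as soon as it contains `∂_l g`. -/
theorem fderiv_single (hg : ContDiff ℝ ∞ g) (l : Fin d)
    (hgl : PolyMul g fun x => fderiv ℝ g x (EuclideanSpace.single l 1)) (hf : PolyMul g f) :
    PolyMul g fun x => fderiv ℝ f x (EuclideanSpace.single l 1) := by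
  induction hf with
  | base => exact hgl
  | @coord k f hf ih =>
    have h : ∀ x, fderiv ℝ (fun x : Space d => (x k : ℂ) * f x) x (EuclideanSpace.single l 1) =
        (x k : ℂ) * fderiv ℝ f x (EuclideanSpace.single l 1) +
          (((EuclideanSpace.single l 1 : Space d) k : ℝ) : ℂ) * f x := by
      intro x
      have h1 : HasFDerivAt (fun x : Space d => (x k : ℂ))
        (Complex.ofRealCLM.comp (EuclideanSpace.proj k : Space d →L[ℝ] ℝ)) x :=
        (Complex.ofRealCLM.comp (EuclideanSpace.proj k : Space d →L[ℝ] ℝ)).hasFDerivAt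
      have h2 := (((hf.contDiff hg).differentiable (by simp)) x).hasFDerivAt
      rw [(h1.fun_mul h2).fderiv, add_apply, smul_apply, smul_apply, smul_eq_mul, smul_eq_mul,
        mul_comm (f x)]
      rfl
    simp only [h]
    exact (ih.coord k).add (hf.const_mul _)
  | add hf₁ hf₂ ih₁ ih₂ =>
    have h := fun x => fderiv_fun_add (((hf₁.contDiff hg).differentiable (by simp)) x)
      (((hf₂.contDiff hg).differentiable (by simp)) x)
    simp only [h, add_apply]
    exact ih₁.add ih₂
  | const_mul c hf ih =>
    have h := fun x => fderiv_const_mul (((hf.contDiff hg).differentiable (by simp)) x) c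
    simp only [h, smul_apply, smul_eq_mul]
    exact ih.const_mul c

theorem raising (hg : ContDiff ℝ ∞ g)
    (hgl : ∀ l : Fin d, PolyMul g fun x => fderiv ℝ g x (EuclideanSpace.single l 1))
    (hf : PolyMul g f) (j : Fin d) : PolyMul g (raising ħ Q P q p j f) := by
  have h1 : PolyMul g fun x => ∑ k, (Pᴴ j k * ((x k : ℂ) * f x)
      + ((Qᴴ j k * p k - Pᴴ j k * q k) * f x + Complex.I * ħ * Qᴴ j k *
          fderiv ℝ f x (EuclideanSpace.single k 1))) :=
    PolyMul.sum _ fun k _ => ((hf.coord k).const_mul _).add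
      ((hf.const_mul _).add ((fderiv_single hg k (hgl k) hf).const_mul _))
  refine (h1.const_mul (Complex.I / (Real.sqrt (2 * ħ) : ℂ))).congr fun x => ?_
  rw [raising_eq]
  congr 1
  rw [Finset.sum_mul, Finset.mul_sum, ← Finset.sum_add_distrib]
  exact Finset.sum_congr rfl fun k _ => by ring

/-- Gaussian decay is inherited by the products with polynomials. -/
theorem gaussian_bound (q : Fin d → ℝ)
    (hg : ∃ b C : ℝ, 0 < b ∧ ∀ x : Space d, ‖g x‖ ≤ C * Real.exp (-(b * ∑ k, (x k - q k) ^ 2)))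
    (hf : PolyMul g f) :
    ∃ b C : ℝ, 0 < b ∧ ∀ x : Space d, ‖f x‖ ≤ C * Real.exp (-(b * ∑ k, (x k - q k) ^ 2)) := by
  induction hf with
  | base => exact hg
  | @coord k f hf ih =>
    obtain ⟨b, C, hb, h⟩ := ih
    -- Half of the decay pays for the factor `x_k`: `|x_k| ≤ |q_k| + 1 + T` and `T ≤ (2/b)
    -- e^{bT/2}`.
    refine ⟨b / 2, (|q k| + 1 + 2 / b) * C, by positivity, fun x => ?_⟩
    set T : ℝ := ∑ k, (x k - q k) ^ 2 with hT
    have hT0 : 0 ≤ T := Finset.sum_nonneg fun k _ => sq_nonneg _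
    have hC : 0 ≤ C := by
      by_contra hC
      have := (norm_nonneg _).trans (h x)
      have h' := mul_neg_of_neg_of_pos (not_le.mp hC)
        (Real.exp_pos (-(b * ∑ k, (x k - q k) ^ 2)))
      linarith
    have hxk : |x k| ≤ (|q k| + 1 + 2 / b) * Real.exp (b / 2 * T) := by
      have h1 : (x k - q k) ^ 2 ≤ T :=
        Finset.single_le_sum (f := fun k => (x k - q k) ^ 2) (fun k _ => sq_nonneg _)
          (Finset.mem_univ k)
      have h2 : |x k| ≤ |q k| + |x k - q k| := by
        have := abs_add_le (q k) (x k - q k)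
        rwa [add_sub_cancel] at this
      have h3 : |x k - q k| ≤ 1 + T := by
        rw [← sq_abs] at h1
        nlinarith [sq_nonneg (|x k - q k| - 1), abs_nonneg (x k - q k)]
      have h4 : b / 2 * T + 1 ≤ Real.exp (b / 2 * T) := Real.add_one_le_exp _
      have h5 : T ≤ 2 / b * Real.exp (b / 2 * T) := by
        have : T = 2 / b * (b / 2 * T) := by field_simp
        rw [this]
        nth_rewrite 2 [← this]
        exact mul_le_mul_of_nonneg_left (by linarith) (by positivity)
      have h6 : 1 ≤ Real.exp (b / 2 * T) := Real.one_le_exp (by positivity)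
      have h7 := mul_le_mul_of_nonneg_left h6 (abs_nonneg (q k))
      linarith
    rw [norm_mul, Complex.norm_real, Real.norm_eq_abs]
    calc |x k| * ‖f x‖ ≤ ((|q k| + 1 + 2 / b) * Real.exp (b / 2 * T)) *
          (C * Real.exp (-(b * T))) :=
          mul_le_mul hxk (h x) (norm_nonneg _) (by positivity)
      _ = (|q k| + 1 + 2 / b) * C * (Real.exp (b / 2 * T) * Real.exp (-(b * T))) := by ring
      _ = (|q k| + 1 + 2 / b) * C * Real.exp (-(b / 2 * T)) := by
        rw [← Real.exp_add]
        congr 2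
        ring
  | add _ _ ih₁ ih₂ =>
    obtain ⟨b₁, C₁, hb₁, h₁⟩ := ih₁
    obtain ⟨b₂, C₂, hb₂, h₂⟩ := ih₂
    -- The signs of the constants are not part of the bound, and lowering the decay rate is monotone
    -- only for nonnegative ones; hence the absolute values.
    refine ⟨min b₁ b₂, |C₁| + |C₂|, lt_min hb₁ hb₂, fun x => ?_⟩
    have hT0 : 0 ≤ ∑ k, (x k - q k) ^ 2 := Finset.sum_nonneg fun k _ => sq_nonneg _
    have aux : ∀ b C : ℝ, min b₁ b₂ ≤ b → C * Real.exp (-(b * ∑ k, (x k - q k) ^ 2)) ≤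
        |C| * Real.exp (-(min b₁ b₂ * ∑ k, (x k - q k) ^ 2)) := fun b C hb =>
      mul_le_mul (le_abs_self C)
        (Real.exp_le_exp.mpr (neg_le_neg (mul_le_mul_of_nonneg_right hb hT0)))
        (Real.exp_pos _).le (abs_nonneg C)
    rw [add_mul]
    exact (norm_add_le _ _).trans (add_le_add ((h₁ x).trans (aux _ _ (min_le_left _ _)))
      ((h₂ x).trans (aux _ _ (min_le_right _ _))))
  | const_mul c _ ih =>
    obtain ⟨b, C, hb, h⟩ := ih
    refine ⟨b, ‖c‖ * C, hb, fun x => ?_⟩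
    rw [norm_mul, mul_assoc]
    exact mul_le_mul_of_nonneg_left (h x) (norm_nonneg c)

end PolyMul

theorem integrable_of_gaussian_bound {f : Space d → ℂ} (hf : Continuous f)
    (h : ∃ b C : ℝ, 0 < b ∧ ∀ x : Space d, ‖f x‖ ≤
      C * Real.exp (-(b * ∑ k, (x k - q k) ^ 2))) : Integrable f := by
  obtain ⟨b, C, hb, h⟩ := h
  have hi : Integrable fun x : Space d => Real.exp (-(b * ∑ k, (x k - q k) ^ 2)) := by
    rw [← (PiLp.volume_preserving_toLp (Fin d)).integrable_comp_emb
      (MeasurableEquiv.toLp 2 _).measurableEmbedding]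
    exact (integrable_exp_neg_mul_sum_sq hb).comp_sub_right q
  exact (hi.const_mul C).mono' hf.aestronglyMeasurable (Filter.Eventually.of_forall h)

theorem groundState_eq (x : Space d) : groundState ħ Q P r q p x =
    r⁻¹ / (((Real.pi * ħ) ^ ((d : ℝ) / 4) : ℝ) : ℂ) * Complex.exp (Complex.I / ħ *
      (1 / 2 * ∑ i, ∑ j, (P * Q⁻¹) i j * (((x i - q i : ℝ) : ℂ) * ((x j - q j : ℝ) : ℂ))
        + ∑ k, (p k : ℂ) * ((x k - q k : ℝ) : ℂ))) := by
  rw [groundState, ← quadForm, quadForm_eq_sum]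
  push_cast
  rfl

/-- The derivative of the exponential of a quadratic polynomial is an affine function times that
exponential. -/
theorem polyMul_fderiv_groundState (l : Fin d) :
    PolyMul (groundState ħ Q P r q p)
      fun x => fderiv ℝ (groundState ħ Q P r q p) x (EuclideanSpace.single l 1) := by
  set g := groundState ħ Q P r q p with hg
  set e : Space d := EuclideanSpace.single l 1
  have hc : ∀ (k : Fin d) (x : Space d), HasFDerivAt (fun x : Space d => ((x k - q k : ℝ) : ℂ))
      (Complex.ofRealCLM.comp (EuclideanSpace.proj k : Space d →L[ℝ] ℝ)) x := by
    intro k x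
    have := ((Complex.ofRealCLM.comp (EuclideanSpace.proj k : Space d →L[ℝ] ℝ)).hasFDerivAt
      (x := x)).sub_const (q k : ℂ)
    refine this.congr_of_eventuallyEq (Filter.Eventually.of_forall fun y => ?_)
    simp
  have hder : ∀ x, fderiv ℝ g x e = Complex.I / ħ *
      (1 / 2 * ∑ i, ∑ j, (P * Q⁻¹) i j * (((x i - q i : ℝ) : ℂ) * ((e j : ℝ) : ℂ)
          + ((x j - q j : ℝ) : ℂ) * ((e i : ℝ) : ℂ))
        + ∑ k, (p k : ℂ) * ((e k : ℝ) : ℂ)) * g x := by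
    intro x
    have h1 := HasFDerivAt.fun_sum (u := Finset.univ) fun (i : Fin d) _ =>
      HasFDerivAt.fun_sum (u := Finset.univ) fun (j : Fin d) _ =>
        ((hc i x).fun_mul (hc j x)).const_mul ((P * Q⁻¹) i j)
    have h2 := HasFDerivAt.fun_sum (u := Finset.univ) fun (k : Fin d) _ =>
      (hc k x).const_mul (p k : ℂ)
    have h3 := ((((h1.const_mul (1 / 2 : ℂ)).fun_add h2).const_mul (Complex.I / ħ)).cexp).const_mul
      (r⁻¹ / (((Real.pi * ħ) ^ ((d : ℝ) / 4) : ℝ) : ℂ))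
    have h4 : HasFDerivAt g _ x := h3.congr_of_eventuallyEq
      (Filter.Eventually.of_forall groundState_eq)
    rw [h4.fderiv, hg, groundState_eq]
    simp only [smul_apply, add_apply, sum_apply, smul_eq_mul, ContinuousLinearMap.comp_apply,
      Complex.ofRealCLM_apply, PiLp.proj_apply]
    ring
  have h5 : PolyMul g fun x => Complex.I / ħ *
      (1 / 2 * (∑ i, ∑ j, (P * Q⁻¹) i j * (((e j : ℝ) : ℂ) * (((x i - q i : ℝ) : ℂ) * g x)
          + ((e i : ℝ) : ℂ) * (((x j - q j : ℝ) : ℂ) * g x)))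
        + (∑ k, (p k : ℂ) * ((e k : ℝ) : ℂ)) * g x) :=
    PolyMul.const_mul _ ((PolyMul.const_mul _ (PolyMul.sum _ fun i _ => PolyMul.sum _ fun j _ =>
      PolyMul.const_mul _ (((PolyMul.base.coord_sub i (q i)).const_mul _).add
        ((PolyMul.base.coord_sub j (q j)).const_mul _)))).add (PolyMul.base.const_mul _))
  refine h5.congr fun x => ?_
  have h6 : ∑ i, ∑ j, (P * Q⁻¹) i j * (((e j : ℝ) : ℂ) * (((x i - q i : ℝ) : ℂ) * g x)
          + ((e i : ℝ) : ℂ) * (((x j - q j : ℝ) : ℂ) * g x)) =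
      (∑ i, ∑ j, (P * Q⁻¹) i j * (((x i - q i : ℝ) : ℂ) * ((e j : ℝ) : ℂ)
          + ((x j - q j : ℝ) : ℂ) * ((e i : ℝ) : ℂ))) * g x := by
    simp only [Finset.sum_mul]
    exact Finset.sum_congr rfl fun i _ => Finset.sum_congr rfl fun j _ => by ring
  rw [hder, h6]
  ring

/-- The linear term and the real part of `P Q⁻¹` contribute only phases; the modulus is governed by
the positive definite imaginary part. -/
theorem gaussian_bound_groundState (hħ : 0 < ħ) (hZ : P * Q⁻¹ ∈ siegel d) :
    ∃ b C : ℝ, 0 < b ∧ ∀ x : Space d, ‖groundState ħ Q P r q p x‖ ≤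
      C * Real.exp (-(b * ∑ k, (x k - q k) ^ 2)) := by
  obtain ⟨c, hc, h⟩ := exists_lower_bound_of_posDef hZ.2
  refine ⟨c / (2 * ħ), ‖r⁻¹ / (((Real.pi * ħ) ^ ((d : ℝ) / 4) : ℝ) : ℂ)‖, by positivity,
    fun x => ?_⟩
  rw [groundState, norm_mul, ← quadForm, Complex.norm_exp]
  refine mul_le_mul_of_nonneg_left (Real.exp_le_exp.mpr ?_) (norm_nonneg _)
  have hre : (Complex.I / ħ * (1 / 2 * quadForm (P * Q⁻¹) (fun k => x k - q k)
      + ((∑ k, p k * (x k - q k) : ℝ) : ℂ))).re =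
      -((quadForm (P * Q⁻¹) (fun k => x k - q k)).im / (2 * ħ)) := by
    have : Complex.I / ħ * (1 / 2 * quadForm (P * Q⁻¹) (fun k => x k - q k)
        + ((∑ k, p k * (x k - q k) : ℝ) : ℂ)) =
        ((1 / (2 * ħ) : ℝ) : ℂ) * (Complex.I * quadForm (P * Q⁻¹) (fun k => x k - q k))
        + (((∑ k, p k * (x k - q k)) / ħ : ℝ) : ℂ) * Complex.I := by
      push_cast
      field_simp
    rw [this, Complex.add_re, Complex.re_ofReal_mul, Complex.I_mul_re, Complex.re_ofReal_mul,
      Complex.I_re]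
    ring
  rw [hre, im_quadForm, neg_le_neg_iff, div_mul_eq_mul_div]
  gcongr
  exact h _

theorem polyMul_foldr_raising (n : Fin d → ℕ) (l : List (Fin d)) :
    PolyMul (groundState ħ Q P r q p)
      (l.foldr (fun j f => (raising ħ Q P q p j)^[n j] f) (groundState ħ Q P r q p)) := by
  induction l with
  | nil => exact PolyMul.base
  | cons a l ih =>
    rw [List.foldr_cons]
    induction n a with
    | zero => exact ih
    | succ m ihm =>
      rw [Function.iterate_succ_apply']
      exact ihm.raising (contDiff_groundState r) polyMul_fderiv_groundState a

theorem integrable_of_polyMul_groundState (hħ : 0 < ħ) (hZ : P * Q⁻¹ ∈ siegel d)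
    {f : Space d → ℂ} (hf : PolyMul (groundState ħ Q P r q p) f) : Integrable f :=
  integrable_of_gaussian_bound (hf.contDiff (contDiff_groundState r)).continuous
    (hf.gaussian_bound q (gaussian_bound_groundState hħ hZ))

theorem semiFourier_raising_of_polyMul (hħ : 0 < ħ) (hZ : P * Q⁻¹ ∈ siegel d)
    {f : Space d → ℂ} (hf : PolyMul (groundState ħ Q P r q p) f) (j : Fin d) :
    semiFourier ħ (raising ħ Q P q p j f) = raising ħ P (-Q) p (-q) j (semiFourier ħ f) :=
  semiFourier_raising hħ (integrable_of_polyMul_groundState hħ hZ hf)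
    ((hf.contDiff (contDiff_groundState r)).differentiable (by simp))
    (fun k => integrable_of_polyMul_groundState hħ hZ (hf.coord k))
    (fun k => integrable_of_polyMul_groundState hħ hZ
      (PolyMul.fderiv_single (contDiff_groundState r) k (polyMul_fderiv_groundState k) hf)) j

theorem semiFourier_foldr_raising (hħ : 0 < ħ) (hZ : P * Q⁻¹ ∈ siegel d) (n : Fin d → ℕ)
    (l : List (Fin d)) :
    semiFourier ħ
      (l.foldr (fun j f => (raising ħ Q P q p j)^[n j] f) (groundState ħ Q P r q p)) =
      l.foldr (fun j f => (raising ħ P (-Q) p (-q) j)^[n j] f)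
        (semiFourier ħ (groundState ħ Q P r q p)) := by
  induction l with
  | nil => rfl
  | cons a l ih =>
    rw [List.foldr_cons, List.foldr_cons, ← ih]
    have h := polyMul_foldr_raising (ħ := ħ) (Q := Q) (P := P) (r := r) (q := q) (p := p) n l
    generalize l.foldr (fun j f => (raising ħ Q P q p j)^[n j] f)
      (groundState ħ Q P r q p) = f at h
    -- Membership in `PolyMul` is carried along the induction because it supplies the integrability
    -- that each intertwining step requires.
    suffices H : ∀ m : ℕ, PolyMul (groundState ħ Q P r q p) ((raising ħ Q P q p a)^[m] f) ∧
        semiFourier ħ ((raising ħ Q P q p a)^[m] f) =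
          (raising ħ P (-Q) p (-q) a)^[m] (semiFourier ħ f) from (H _).2
    intro m
    induction m with
    | zero => exact ⟨h, rfl⟩
    | succ m ihm =>
      rw [Function.iterate_succ_apply', Function.iterate_succ_apply', ← ihm.2]
      exact ⟨ihm.1.raising (contDiff_groundState r) polyMul_fderiv_groundState a,
        semiFourier_raising_of_polyMul hħ hZ ihm.1 a⟩

/-- Lets the constant produced by the ground state pass through all raising operators. -/
theorem foldr_raising_smul (c : ℂ) (f : Space d → ℂ) (n : Fin d → ℕ) (l : List (Fin d)) :
    l.foldr (fun j f => (raising ħ Q P q p j)^[n j] f) (c • f) =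
      c • l.foldr (fun j f => (raising ħ Q P q p j)^[n j] f) f := by
  have iter : ∀ (j : Fin d) (m : ℕ) (g : Space d → ℂ),
      (raising ħ Q P q p j)^[m] (c • g) = c • (raising ħ Q P q p j)^[m] g := by
    intro j m g
    induction m with
    | zero => rfl
    | succ m ih => rw [Function.iterate_succ_apply', Function.iterate_succ_apply', ih, raising_smul]
  induction l with
  | nil => rfl
  | cons a l ih => rw [List.foldr_cons, List.foldr_cons, ih, iter]

theorem integrable_wavePacket (hħ : 0 < ħ) (hZ : P * Q⁻¹ ∈ siegel d) (n : Fin d → ℕ) :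
    Integrable (wavePacket ħ Q P r q p n) :=
  (integrable_of_polyMul_groundState hħ hZ (polyMul_foldr_raising n _)).smul _

theorem semiFourier_wavePacket (hħ : 0 < ħ) (h1 : Qᵀ * P - Pᵀ * Q = 0)
    (h2 : Qᴴ * P - Pᴴ * Q = (2 * Complex.I) • (1 : CMat d)) (r : ℂ) (q p : Fin d → ℝ)
    (n : Fin d → ℕ) :
    semiFourier ħ (wavePacket ħ Q P r q p n) =
      (Complex.I ^ ((d : ℂ) / 2) * Complex.exp (-(Complex.I / ħ) * (∑ k, p k * q k : ℝ))) •
        wavePacket ħ P (-Q) (r * sqrtDet (P * Q⁻¹)) p (-q) n := by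
  have hc : ∀ (c : ℂ) (f : Space d → ℂ), semiFourier ħ (c • f) = c • semiFourier ħ f :=
    fun c f => semiFourier_const_mul c f
  rw [wavePacket, hc, semiFourier_foldr_raising hħ (mul_inv_mem_siegel h1 h2),
    semiFourier_groundState hħ h1 h2, foldr_raising_smul, smul_comm]
  rfl

theorem mul_sqrtDet_sq (h1 : Qᵀ * P - Pᵀ * Q = 0)
    (h2 : Qᴴ * P - Pᴴ * Q = (2 * Complex.I) • (1 : CMat d)) (hr : r ^ 2 = Q.det) :
    (r * sqrtDet (P * Q⁻¹)) ^ 2 = P.det := by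
  rw [mul_pow, hr, sqrtDet_sq (mul_inv_mem_siegel h1 h2), mul_comm, ← Matrix.det_mul,
    Matrix.mul_assoc, Matrix.nonsing_inv_mul _ (isUnit_det_Q h2), Matrix.mul_one]

/-! ### From symplectic matrices to the pair `Q`, `P` -/

section Symplectic

variable (S : PhaseMat d)

theorem blockQ_eq : blockQ S = S.toBlocks₁₁.map Complex.ofReal
    + Complex.I • S.toBlocks₁₂.map Complex.ofReal := rfl

theorem blockP_eq : blockP S = S.toBlocks₂₁.map Complex.ofReal
    + Complex.I • S.toBlocks₂₂.map Complex.ofReal := rfl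

theorem symJ_mul : symJ d * S = Matrix.fromBlocks S.toBlocks₂₁ S.toBlocks₂₂
    (-S.toBlocks₁₁) (-S.toBlocks₁₂) := by
  conv_lhs => rw [← Matrix.fromBlocks_toBlocks S]
  rw [symJ, Matrix.fromBlocks_multiply]
  simp

theorem blockQ_symJ_mul : blockQ (symJ d * S) = blockP S := by
  rw [symJ_mul]
  rfl

theorem blockP_symJ_mul : blockP (symJ d * S) = -blockQ S := by
  rw [symJ_mul]
  ext i j
  simp [blockP, blockQ, Matrix.toBlocks₁₁, Matrix.toBlocks₁₂]
  ring

variable {S}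

theorem symplectic_blocks (hS : S ∈ Matrix.symplecticGroup (Fin d) ℝ) :
    S.toBlocks₁₁ᵀ * S.toBlocks₂₁ = S.toBlocks₂₁ᵀ * S.toBlocks₁₁ ∧
    S.toBlocks₁₂ᵀ * S.toBlocks₂₂ = S.toBlocks₂₂ᵀ * S.toBlocks₁₂ ∧
    S.toBlocks₁₁ᵀ * S.toBlocks₂₂ - S.toBlocks₂₁ᵀ * S.toBlocks₁₂ = 1 := by
  have h := SymplecticGroup.mem_iff'.mp hS
  rw [← Matrix.fromBlocks_toBlocks S, Matrix.J, Matrix.fromBlocks_transpose,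
    Matrix.fromBlocks_multiply, Matrix.fromBlocks_multiply, Matrix.fromBlocks_inj] at h
  simp only [Matrix.mul_zero, Matrix.mul_one, Matrix.mul_neg, zero_add, add_zero,
    Matrix.neg_mul] at h
  -- The lower left block of `Sᵀ J S = J` is dropped, being minus the transpose of the upper right
  -- one. `Matrix.J` is the negative of `symJ`, which does not affect this relation.
  obtain ⟨ha, hb, -, hd⟩ := h
  refine ⟨?_, ?_, ?_⟩
  · rw [eq_comm, ← sub_eq_zero, ← ha]; abel
  · rw [eq_comm, ← sub_eq_zero, ← hd]; abel
  · rw [← neg_inj, ← hb]; abel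

theorem map_symplectic_blocks (hS : S ∈ Matrix.symplecticGroup (Fin d) ℝ) :
    S.toBlocks₁₁ᵀ.map Complex.ofReal * S.toBlocks₂₁.map Complex.ofReal =
      S.toBlocks₂₁ᵀ.map Complex.ofReal * S.toBlocks₁₁.map Complex.ofReal ∧
    S.toBlocks₁₂ᵀ.map Complex.ofReal * S.toBlocks₂₂.map Complex.ofReal =
      S.toBlocks₂₂ᵀ.map Complex.ofReal * S.toBlocks₁₂.map Complex.ofReal ∧
    S.toBlocks₁₁ᵀ.map Complex.ofReal * S.toBlocks₂₂.map Complex.ofReal =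
      1 + S.toBlocks₂₁ᵀ.map Complex.ofReal * S.toBlocks₁₂.map Complex.ofReal ∧
    S.toBlocks₂₂ᵀ.map Complex.ofReal * S.toBlocks₁₁.map Complex.ofReal =
      1 + S.toBlocks₁₂ᵀ.map Complex.ofReal * S.toBlocks₂₁.map Complex.ofReal := by
  obtain ⟨h1, h2, h3⟩ := symplectic_blocks hS
  have h3' := sub_eq_iff_eq_add.mp h3
  have h4 : S.toBlocks₂₂ᵀ * S.toBlocks₁₁ = 1 + S.toBlocks₁₂ᵀ * S.toBlocks₂₁ := by
    simpa using congrArg Matrix.transpose h3'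
  have hone : (1 : Matrix (Fin d) (Fin d) ℝ).map Complex.ofReal = 1 :=
    Matrix.map_one _ Complex.ofReal_zero Complex.ofReal_one
  simp only [← map_ofReal_mul, h1, h2, h3', h4, Matrix.map_add _ Complex.ofReal_add, hone, and_self]

theorem transpose_blockQ_mul_blockP (hS : S ∈ Matrix.symplecticGroup (Fin d) ℝ) :
    (blockQ S)ᵀ * blockP S - (blockP S)ᵀ * blockQ S = 0 := by
  obtain ⟨h1, h2, h3, h4⟩ := map_symplectic_blocks hS
  rw [blockQ_eq, blockP_eq]
  simp only [Matrix.transpose_add, Matrix.transpose_smul, ← Matrix.transpose_map, Matrix.add_mul,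
    Matrix.mul_add, Matrix.smul_mul, Matrix.mul_smul, h1, h2, h3, h4]
  module

/-- The real terms cancel by symmetry, as in the transposed relation. Conjugation flips one sign in
the imaginary part, so the two unit contributions add up to `2i` instead of cancelling. -/
theorem conjTranspose_blockQ_mul_blockP (hS : S ∈ Matrix.symplecticGroup (Fin d) ℝ) :
    (blockQ S)ᴴ * blockP S - (blockP S)ᴴ * blockQ S = (2 * Complex.I) • (1 : CMat d) := by
  obtain ⟨h1, h2, h3, h4⟩ := map_symplectic_blocks hS
  have hconj : ∀ A : Matrix (Fin d) (Fin d) ℝ,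
      (A.map Complex.ofReal)ᴴ = Aᵀ.map Complex.ofReal := fun A => by
    ext i j
    simp
  rw [blockQ_eq, blockP_eq]
  simp only [Matrix.conjTranspose_add, Matrix.conjTranspose_smul, hconj, Complex.star_def,
    Complex.conj_I, Matrix.add_mul, Matrix.mul_add, Matrix.smul_mul, Matrix.mul_smul,
    h1, h2, h3, h4]
  module

end Symplectic

end

end Hagedorn

/-! ### The theorem in both parametrizations -/

theorem mainTheorem8 (d : ℕ) :
    ∃ s : Hagedorn.CMat d → ℂ,
      -- `s` is the continuous branch of `(det Z)^{1/2}` on the Siegel upper half space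
      -- with value `i^{d/2}` at `i I`; it relates the square roots of `det Q` and `det P`.
      ContinuousOn s (Hagedorn.siegel d) ∧
      (∀ Z ∈ Hagedorn.siegel d, s Z ^ 2 = Z.det) ∧
      s (Complex.I • (1 : Hagedorn.CMat d)) = Complex.I ^ ((d : ℂ) / 2) ∧
      -- the form with a symplectic matrix `S` and a phase space point `z = (q, p)`
      (∀ ħ : ℝ, 0 < ħ → ∀ S ∈ Matrix.symplecticGroup (Fin d) ℝ,
        ∀ r : ℂ, r ^ 2 = (Hagedorn.blockQ S).det →
          (r * s (Hagedorn.blockP S * (Hagedorn.blockQ S)⁻¹)) ^ 2 =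
              (Hagedorn.blockQ (Hagedorn.symJ d * S)).det ∧
          ∀ (z : Fin d ⊕ Fin d → ℝ) (n : Fin d → ℕ),
            MeasureTheory.Integrable (Hagedorn.wavePacketS ħ S r z n) ∧
            Hagedorn.semiFourier ħ (Hagedorn.wavePacketS ħ S r z n) =
              (Complex.I ^ ((d : ℂ) / 2) *
                Complex.exp (-(Complex.I / ħ) *
                  (∑ k, z (Sum.inr k) * z (Sum.inl k) : ℝ))) •
              Hagedorn.wavePacketS ħ (Hagedorn.symJ d * S)
                (r * s (Hagedorn.blockP S * (Hagedorn.blockQ S)⁻¹))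
                (Matrix.mulVec (Hagedorn.symJ d) z) n) ∧
      -- the explicit form with complex matrices `Q`, `P` and vectors `q`, `p`
      (∀ ħ : ℝ, 0 < ħ → ∀ Q P : Hagedorn.CMat d,
        Q.transpose * P - P.transpose * Q = 0 →
        Q.conjTranspose * P - P.conjTranspose * Q = (2 * Complex.I) • (1 : Hagedorn.CMat d) →
        ∀ r : ℂ, r ^ 2 = Q.det →
          (r * s (P * Q⁻¹)) ^ 2 = P.det ∧
          ∀ (q p : Fin d → ℝ) (n : Fin d → ℕ),
            MeasureTheory.Integrable (Hagedorn.wavePacket ħ Q P r q p n) ∧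
            Hagedorn.semiFourier ħ (Hagedorn.wavePacket ħ Q P r q p n) =
              (Complex.I ^ ((d : ℂ) / 2) *
                Complex.exp (-(Complex.I / ħ) * (∑ k, p k * q k : ℝ))) •
              Hagedorn.wavePacket ħ P (-Q) (r * s (P * Q⁻¹)) p (-q) n) := by
  open Hagedorn in
  have explicit : ∀ ħ : ℝ, 0 < ħ → ∀ Q P : CMat d, Qᵀ * P - Pᵀ * Q = 0 →
      Qᴴ * P - Pᴴ * Q = (2 * Complex.I) • (1 : CMat d) → ∀ r : ℂ, r ^ 2 = Q.det →
      (r * sqrtDet (P * Q⁻¹)) ^ 2 = P.det ∧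
      ∀ (q p : Fin d → ℝ) (n : Fin d → ℕ), Integrable (wavePacket ħ Q P r q p n) ∧
        semiFourier ħ (wavePacket ħ Q P r q p n) =
          (Complex.I ^ ((d : ℂ) / 2) *
            Complex.exp (-(Complex.I / ħ) * (∑ k, p k * q k : ℝ))) •
          wavePacket ħ P (-Q) (r * sqrtDet (P * Q⁻¹)) p (-q) n :=
    fun ħ hħ Q P h1 h2 r hr => ⟨mul_sqrtDet_sq h1 h2 hr, fun q p n =>
      ⟨integrable_wavePacket hħ (mul_inv_mem_siegel h1 h2) n,
        semiFourier_wavePacket hħ h1 h2 r q p n⟩⟩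
  refine ⟨Hagedorn.sqrtDet, Hagedorn.continuousOn_sqrtDet, fun Z hZ => Hagedorn.sqrtDet_sq hZ,
    Hagedorn.sqrtDet_I_smul_one, fun ħ hħ S hS r hr => ?_, explicit⟩
  obtain ⟨h1, h2⟩ := explicit ħ hħ _ _ (Hagedorn.transpose_blockQ_mul_blockP hS)
    (Hagedorn.conjTranspose_blockQ_mul_blockP hS) r hr
  -- Left multiplication by `J` replaces `(Q, P)` by `(P, -Q)` and `(q, p)` by `(p, -q)`, so the
  -- symplectic form is the explicit one.
  rw [Hagedorn.blockQ_symJ_mul]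
  refine ⟨h1, fun z n => ?_⟩
  have hz1 : (fun k => Matrix.mulVec (Hagedorn.symJ d) z (Sum.inl k)) = fun k => z (Sum.inr k) := by
    ext k
    simp [Hagedorn.symJ, Matrix.fromBlocks_mulVec]
  have hz2 : (fun k => Matrix.mulVec (Hagedorn.symJ d) z (Sum.inr k)) =
      -fun k => z (Sum.inl k) := by
    ext k
    simp [Hagedorn.symJ, Matrix.fromBlocks_mulVec, Matrix.neg_mulVec]
  simp only [Hagedorn.wavePacketS, Hagedorn.blockQ_symJ_mul, Hagedorn.blockP_symJ_mul, hz1, hz2]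
  exact h2 _ _ n
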